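/- Let $p$ be an odd prime, let $\mathbb{K}$ be the unramified quadratic extension of $\mathbb{Q}_p$ with ring of integers $\mathcal{O}$, and let $G=\mathrm{PGL}_2(\mathbb{K})$, acting on its Bruhat--Tits tree $T_G$, whose set of vertices is $G/\mathrm{PGL}_2(\mathcal{O})$, with graph distance $d$. Schottky groups. An element $\gamma\in G$ is hyperbolic if $\gamma=g\,\mathrm{diag}(p^{-k}a,1)\,g^{-1}$ for some $g\in G$, $k\ge 1$ and $a\in\mathcal{O}^\times$; its axis is the geodesic of $T_G$ from $\gamma^-=g.0$ to $\gamma^+=g.\infty$. Label the vertices of the axis consecutively, from $\gamma^-$ to $\gamma^+$, by $(v_j)_{j\in\mathbb{Z}}$, and put $O^+=\{v: d(v,v_{k+1})<d(v,v_k)\}$ and $O^-=\{v: d(v,v_0)<d(v,v_1)\}$. A subgroup of $G$ is called a Schottky group if it is generated by hyperbolic elements $\gamma_1,\dots,\gamma_n$ with $n\ge2$ for which there are labellings of the axes such that the $2n$ sets $O_1^{+},\dots,O_n^{+},O_1^{-},\dots,O_n^{-}$ are mutually disjoint. Zariski density. Regard $G$ as a group over $\mathbb{Q}_p$: a subset of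 $G$ is a $\mathbb{Q}_p$-algebraic subvariety if its preimage in $\mathrm{GL}_2(\mathbb{K})$ is the zero set of a family of polynomials over $\mathbb{Q}_p$ in the eight $\mathbb{Q}_p$-coordinates of a matrix. A subgroup $\Gamma\subset G$ is Zariski dense if no proper $\mathbb{Q}_p$-algebraic subvariety of $G$ contains it. Rotational parts. Let $\mu_{p^2-1}\subset\mathbb{K}^\times$ be the group of $(p^2-1)$-th roots of unity and $\mathbb{S}^1_p=\{z\in 1+p\mathcal{O}: N_{\mathbb{K}/\mathbb{Q}_p}(z)=1\}$; if $\mathbb{K}=\mathbb{Q}_p(\omega)$ with $\omega^2\in\mathbb{Q}_p$, then $\mathbb{S}^1_p=\{x+\omega y\in1+p\mathcal{O}: x,y\in\mathbb{Q}_p,\ x^2-\omega^2y^2=1\}$. A rotational part of a hyperbolic element $\gamma\in G$ is an element $\Theta_\gamma\in\mu_{p^2-1}\cdot\mathbb{S}^1_p$ such that $\gamma$ is conjugate to $\mathrm{diag}(p^{n}r\,\Theta_\gamma,1)$ for some $n\in\mathbb{Z}\setminus\{0\}$ and $r\in1+p\mathbb{Z}_p$ (it is unique up to inversion). Let $\Omega(\Gamma)$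 be the set of all rotational parts of hyperbolic elements of $\Gamma$. **Proposition.** There exists a Zariski dense Schottky subgroup $\Gamma$ of $G$ such that $\Omega(\Gamma)$ is not dense in $\mu_{p^2-1}\cdot\mathbb{S}^1_p$. Moreover, this $\Gamma$ does not satisfy condition (2) in the definition of a highly-branched group, namely that there is $\gamma\in\Gamma$ for which $\{\Theta_\gamma^n:n\in\mathbb{Z}_{\ge0}\}$ is dense in $\mu_{p^2-1}\cdot\mathbb{S}^1_p$. -/

import Mathlib

open scoped MatrixGroups Pointwise

noncomputable section

namespace PadicSchottky

/-! ### The field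

`K` is a normed field extension of `ℚ_[p]`.  Since `K` will be finite over `ℚ_[p]`, its norm is
the unique extension of the `p`-adic norm. -/

/-- `K` is an unramified quadratic extension of `ℚ_[p]`: it has degree `2`, and its value group is
that of `ℚ_[p]` (ramification index `1`), i.e. `p` is a uniformizer of `K`. -/
structure IsUnramifiedQuadratic (p : ℕ) [Fact p.Prime] (K : Type*) [NormedField K]
    [NormedAlgebra ℚ_[p] K] : Prop where
  finrank_eq : Module.finrank ℚ_[p] K = 2
  norm_eq_zpow : ∀ x : K, x ≠ 0 → ∃ n : ℤ, ‖x‖ = (p : ℝ) ^ n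

theorem isUltrametricDist (p : ℕ) [Fact p.Prime] (K : Type*) [NormedField K]
    [NormedAlgebra ℚ_[p] K] : IsUltrametricDist K := by
  refine IsUltrametricDist.isUltrametricDist_of_forall_norm_natCast_le_one fun n => ?_
  have h : ‖(algebraMap ℚ_[p] K) (n : ℚ_[p])‖ = ‖(n : ℚ_[p])‖ := norm_algebraMap' K _
  rw [map_natCast] at h
  rw [h]
  exact IsUltrametricDist.norm_natCast_le_one ℚ_[p] n

theorem natCast_p_ne_zero (p : ℕ) [Fact p.Prime] (K : Type*) [NormedField K]
    [NormedAlgebra ℚ_[p] K] : (p : K) ≠ 0 := by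
  have h : (algebraMap ℚ_[p] K) (p : ℚ_[p]) ≠ 0 := by
    rw [Ne, map_eq_zero]
    exact_mod_cast (Fact.out : p.Prime).ne_zero
  rwa [map_natCast] at h

/-- The ring of integers `𝒪 = {x ∈ K : |x| ≤ 1}`. -/
def integers (p : ℕ) [Fact p.Prime] (K : Type*) [NormedField K]
    [NormedAlgebra ℚ_[p] K] : Subring K where
  carrier := {x | ‖x‖ ≤ 1}
  mul_mem' {a b} ha hb := by
    have ha' : ‖a‖ ≤ 1 := ha
    have hb' : ‖b‖ ≤ 1 := hb
    simpa [norm_mul] using mul_le_one₀ ha' (norm_nonneg b) hb'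
  one_mem' := by simp
  add_mem' {a b} ha hb := by
    have := isUltrametricDist p K
    exact (IsUltrametricDist.norm_add_le_max a b).trans (max_le ha hb)
  zero_mem' := by simp
  neg_mem' {a} ha := by simpa using ha

section

variable (p : ℕ) [Fact p.Prime] (K : Type*) [NormedField K] [NormedAlgebra ℚ_[p] K]

/-- `p` as a unit of `K`. -/
def unitP : Kˣ := Units.mk0 (p : K) (natCast_p_ne_zero p K)

/-- The group `μ_{p²-1}` of `(p²-1)`-th roots of unity in `K`. -/
def rootsOfOne : Set K := {z | z ^ (p ^ 2 - 1) = 1}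

/-- The `p`-adic circle `𝕊¹_p`: the elements of `1 + p𝒪` of norm one over `ℚ_[p]`. -/
def circle : Set K := {z | (∃ w ∈ integers p K, z = 1 + p * w) ∧ Algebra.norm ℚ_[p] z = 1}

/-- If `K = ℚ_p(ω)` with `ω² ∈ ℚ_p`, then `𝕊¹_p` is the set of the `x + ωy ∈ 1 + p𝒪` with
`x² - ω²y² = 1`. -/
theorem mem_circle_iff (hK : Module.finrank ℚ_[p] K = 2) (ω : K) (d : ℚ_[p])
    (hω : ω ^ 2 = algebraMap ℚ_[p] K d) (hω' : ω ∉ Set.range (algebraMap ℚ_[p] K)) (z : K) :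
    z ∈ circle p K ↔ (∃ w ∈ integers p K, z = 1 + p * w) ∧
      ∃ x y : ℚ_[p], z = algebraMap ℚ_[p] K x + ω * algebraMap ℚ_[p] K y ∧
        (algebraMap ℚ_[p] K x) ^ 2 - ω ^ 2 * (algebraMap ℚ_[p] K y) ^ 2 = 1 := by
  have hli : LinearIndependent ℚ_[p] ![(1 : K), ω] := by
    rw [LinearIndependent.pair_iff]
    intro s t h
    have ht : t = 0 := by
      by_contra ht
      apply hω'
      refine ⟨-s / t, ?_⟩
      have ht' : algebraMap ℚ_[p] K t ≠ 0 := by simpa using ht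
      rw [Algebra.smul_def, Algebra.smul_def, mul_one] at h
      rw [map_div₀, map_neg, div_eq_iff ht']
      linear_combination -h
    subst ht
    refine ⟨?_, rfl⟩
    simpa [Algebra.smul_def] using h
  let b := basisOfLinearIndependentOfCardEqFinrank hli (by simp [hK])
  have hb : (b : Fin 2 → K) = ![1, ω] := coe_basisOfLinearIndependentOfCardEqFinrank _ _
  have hb0 : b 0 = 1 := by simp [hb]
  have hb1 : b 1 = ω := by simp [hb]
  have hnorm : ∀ x y : ℚ_[p],
      Algebra.norm ℚ_[p] (algebraMap ℚ_[p] K x + ω * algebraMap ℚ_[p] K y) = x ^ 2 - d * y ^ 2 := by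
    intro x y
    rw [Algebra.norm_eq_matrix_det b, Matrix.det_fin_two]
    simp only [Algebra.leftMulMatrix_eq_repr_mul]
    have e0 : (algebraMap ℚ_[p] K x + ω * algebraMap ℚ_[p] K y) * b 0 = x • b 0 + y • b 1 := by
      rw [hb0, hb1, Algebra.smul_def, Algebra.smul_def]; ring
    have e1 : (algebraMap ℚ_[p] K x + ω * algebraMap ℚ_[p] K y) * b 1
        = (d * y) • b 0 + x • b 1 := by
      rw [hb0, hb1, Algebra.smul_def, Algebra.smul_def, map_mul, ← hω]; ring
    rw [e0, e1]
    simp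
    ring
  have hval : ∀ x y : ℚ_[p], ((algebraMap ℚ_[p] K x) ^ 2 - ω ^ 2 * (algebraMap ℚ_[p] K y) ^ 2 = 1
      ↔ x ^ 2 - d * y ^ 2 = 1) := by
    intro x y
    rw [hω, ← map_pow, ← map_pow, ← map_mul, ← map_sub, map_eq_one_iff _
      (algebraMap ℚ_[p] K).injective]
  unfold circle
  simp only [Set.mem_ofPred_eq]
  refine and_congr_right fun _ => ⟨fun h => ?_, ?_⟩
  · have hz := b.sum_repr z
    rw [Fin.sum_univ_two, hb0, hb1, Algebra.smul_def, Algebra.smul_def, mul_one] at hz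
    have hz' : z = algebraMap ℚ_[p] K (b.repr z 0) + ω * algebraMap ℚ_[p] K (b.repr z 1) := by
      rw [mul_comm ω]; exact hz.symm
    refine ⟨_, _, hz', ?_⟩
    rw [hval, ← hnorm, ← hz', h]
  · rintro ⟨x, y, rfl, h⟩
    rw [hnorm, ← hval, h]

/-- The compact group `μ_{p²-1} · 𝕊¹_p ⊆ 𝒪ˣ` of "rotations". -/
def rotations : Set K := rootsOfOne p K * circle p K

/-! ### The Bruhat–Tits tree of `PGL₂(K)` -/

/-- The image of `GL₂(𝒪)` in `PGL₂(K)`. -/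
def maximalCompact : Subgroup PGL(2, K) :=
  (Matrix.ProjGenLinGroup.mk.comp
    (Matrix.GeneralLinearGroup.map (n := Fin 2) (integers p K).subtype)).range

/-- The vertices of the tree, `PGL₂(K) / PGL₂(𝒪)`, with `PGL₂(K)` acting on the left. -/
abbrev Vertex : Type _ := PGL(2, K) ⧸ maximalCompact p K

/-- The vertex represented by a matrix. -/
def vertexOf (g : GL (Fin 2) K) : Vertex p K := (Matrix.ProjGenLinGroup.mk g : PGL(2, K))

/-- The `𝒪`-lattice `g 𝒪²` in `K²`. -/
def lattice (g : GL (Fin 2) K) : Set (Fin 2 → K) :=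
  {v | ∃ x : Fin 2 → K, (∀ i, x i ∈ integers p K) ∧ v = (g : Matrix (Fin 2) (Fin 2) K).mulVec x}

/-- The Bruhat–Tits tree: vertices are homothety classes of lattices, and two distinct vertices
are adjacent iff they have representatives `L`, `M` with `pL ⊊ M ⊊ L` or `pM ⊊ L ⊊ M`
(`SimpleGraph.fromRel` symmetrizes the relation). -/
def tree : SimpleGraph (Vertex p K) :=
  SimpleGraph.fromRel fun v w => ∃ g h : GL (Fin 2) K, v = vertexOf p K g ∧ w = vertexOf p K h ∧
    (p : K) • lattice p K g ⊂ lattice p K h ∧ lattice p K h ⊂ lattice p K g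

variable {K}

/-- The matrix `diag(x, 1)`. -/
def diag (x : Kˣ) : GL (Fin 2) K where
  val := Matrix.diagonal ![(x : K), 1]
  inv := Matrix.diagonal ![((x⁻¹ : Kˣ) : K), 1]
  val_inv := by
    ext i j; fin_cases i <;> fin_cases j <;> simp
  inv_val := by
    ext i j; fin_cases i <;> fin_cases j <;> simp

/-! ### Schottky groups -/

/-- `γ = g diag(p^{-k} a, 1) g⁻¹` with `k ≥ 1` and `a ∈ 𝒪ˣ`: the element `γ` is hyperbolic with
translation length `k`, its repelling fixed point is `g.0` and its attracting one `g.∞`. -/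
def IsHyperbolicForm (γ : PGL(2, K)) (g : GL (Fin 2) K) (k : ℕ) (a : Kˣ) : Prop :=
  1 ≤ k ∧ ‖(a : K)‖ = 1 ∧
    γ = Matrix.ProjGenLinGroup.mk (g * diag (unitP p K ^ (-(k : ℤ)) * a) * g⁻¹)

/-- `v` labels consecutively the vertices of the geodesic from `g.0` to `g.∞`, in this direction.
That geodesic is the image under `g` of the one through the vertices `[diag(p^j, 1)]`, `j ∈ ℤ`,
which runs to `∞` as `j → -∞`. -/
def IsAxisLabelling (g : GL (Fin 2) K) (v : ℤ → Vertex p K) : Prop :=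
  ∃ m : ℤ, ∀ j : ℤ, v j = vertexOf p K (g * diag (unitP p K ^ (m - j)))

/-- The half-tree `O⁺` of the vertices closer to `v_{k+1}` than to `v_k`. -/
def halfTreePos (k : ℕ) (v : ℤ → Vertex p K) : Set (Vertex p K) :=
  {u | (tree p K).dist u (v (k + 1)) < (tree p K).dist u (v k)}

/-- The half-tree `O⁻` of the vertices closer to `v_0` than to `v_1`. -/
def halfTreeNeg (v : ℤ → Vertex p K) : Set (Vertex p K) :=
  {u | (tree p K).dist u (v 0) < (tree p K).dist u (v 1)}

/-- `γ_1, …, γ_n` is a Schottky basis: `n ≥ 2`, all `γ_i` are hyperbolic, and the vertices of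
their axes can be labelled, each from its repelling to its attracting end, such that the `2n`
half-trees `O⁺_1, …, O⁺_n, O⁻_1, …, O⁻_n` are mutually disjoint. -/
def IsSchottkyBasis {n : ℕ} (γ : Fin n → PGL(2, K)) : Prop :=
  2 ≤ n ∧ ∃ (g : Fin n → GL (Fin 2) K) (k : Fin n → ℕ) (a : Fin n → Kˣ)
    (v : Fin n → ℤ → Vertex p K),
    (∀ i, IsHyperbolicForm p (γ i) (g i) (k i) (a i)) ∧
    (∀ i, IsAxisLabelling p (g i) (v i)) ∧
    Pairwise fun s t : Fin n ⊕ Fin n => Disjoint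
      (Sum.elim (fun i => halfTreePos p (k i) (v i)) (fun i => halfTreeNeg p (v i)) s)
      (Sum.elim (fun i => halfTreePos p (k i) (v i)) (fun i => halfTreeNeg p (v i)) t)

/-- A Schottky group is a subgroup of `PGL₂(K)` generated by a Schottky basis. -/
def IsSchottky (Γ : Subgroup PGL(2, K)) : Prop :=
  ∃ (n : ℕ) (γ : Fin n → PGL(2, K)), IsSchottkyBasis p γ ∧ Γ = Subgroup.closure (Set.range γ)

/-! ### Zariski density, `PGL₂(K)` being regarded as a group over `ℚ_p` -/

variable (K) in
/-- The `ℚ_p`-valued polynomial functions on the `8`-dimensional `ℚ_p`-vector space `M₂(K)`,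
i.e. the `ℚ_p`-algebra of functions generated by the `ℚ_p`-linear forms. -/
def polynomialFunctions : Subalgebra ℚ_[p] (Matrix (Fin 2) (Fin 2) K → ℚ_[p]) :=
  Algebra.adjoin ℚ_[p]
    {f | ∃ ℓ : Matrix (Fin 2) (Fin 2) K →ₗ[ℚ_[p]] ℚ_[p], ∀ M, f M = ℓ M}

/-- A set in `PGL₂(K)` is a `ℚ_p`-algebraic subvariety (Zariski closed over `ℚ_p`) if its preimage
in `GL₂(K)` is the set of common zeros in `GL₂(K)` of a family of polynomials with coefficients
in `ℚ_p` in the `8` coordinates of the matrix over `ℚ_p`. -/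
def IsSubvariety (Z : Set PGL(2, K)) : Prop :=
  ∃ S ⊆ (polynomialFunctions p K : Set (Matrix (Fin 2) (Fin 2) K → ℚ_[p])),
    ∀ g : GL (Fin 2) K, Matrix.ProjGenLinGroup.mk g ∈ Z ↔
      ∀ f ∈ S, f (g : Matrix (Fin 2) (Fin 2) K) = 0

/-- `Γ` is Zariski dense: no proper `ℚ_p`-algebraic subvariety of `PGL₂(K)` contains `Γ`. -/
def IsZariskiDense (Γ : Subgroup PGL(2, K)) : Prop :=
  ∀ Z : Set PGL(2, K), IsSubvariety p Z → (Γ : Set PGL(2, K)) ⊆ Z → Z = Set.univ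

/-! ### Rotational parts -/

/-- `Θ ∈ μ_{p²-1} · 𝕊¹_p` is a rotational part of the hyperbolic element `γ`: `γ` is conjugate to
`diag(p^n r Θ, 1)` with `n ≠ 0` and `r ∈ 1 + pℤ_p`.  (It is unique up to inversion, which
corresponds to exchanging the two eigenvalues.) -/
def IsRotationalPart (γ : PGL(2, K)) (Θ : K) : Prop :=
  Θ ∈ rotations p K ∧ ∃ (g : GL (Fin 2) K) (n : ℤ) (r : ℤ_[p]) (x : Kˣ), n ≠ 0 ∧
    (x : K) = (p : K) ^ n * algebraMap ℚ_[p] K (1 + p * r) * Θ ∧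
    γ = Matrix.ProjGenLinGroup.mk (g * diag x * g⁻¹)

/-- The set `Ω(Γ)` of the rotational parts of the hyperbolic elements of `Γ`. -/
def rotationalParts (Γ : Subgroup PGL(2, K)) : Set K :=
  {Θ | ∃ γ ∈ Γ, IsRotationalPart p γ Θ}

/-- The second condition in the definition of a highly-branched group: for some `γ ∈ Γ` the powers
`Θ_γ^n`, `n ≥ 0`, of its rotational part are dense in `μ_{p²-1} · 𝕊¹_p`. -/
def HasDenseRotation (Γ : Subgroup PGL(2, K)) : Prop :=
  ∃ γ ∈ Γ, ∃ Θ : K, IsRotationalPart p γ Θ ∧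
    rotations p K ⊆ closure (Set.range fun n : ℕ => Θ ^ n)

end

end PadicSchottky

end

noncomputable section

namespace PadicSchottky

/-! The obstruction is the ring `R = ℤ_p + p²𝒪` (`nearRational`), which is closed in `K` and omits
some rotations, for instance `(1 + pω)/(1 - pω)`, congruent to `1 + 2pω` modulo `p²`. It suffices to
find a Zariski dense Schottky group whose rotational parts all lie in `R`: the closure of the set of
rotational parts, and that of the powers of any one of them, then stay in `R`.

Take `β = p(1 + p²ω)` and the group generated by `diag(β⁻¹, 1)` and its conjugate by `!![1, -1; 1,
1]`. The factor `1 + p²ω` lies in `R`, yet no positive power of `β` is fixed by the conjugation `σ`.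
The ends of the two axes are `0, ∞` and `-1, 1`, four distinct points modulo the odd prime `p`,
which gives the Schottky property (`SqrtGenerator.isSchottky`).

Rotational parts (`SqrtGenerator.rotationalParts_subset`): up to conjugacy a nontrivial element is a
cyclically reduced word. Scaled to have entries in `R`, its matrix has determinant `βⁿ` and, being
of rank one modulo `p` with nonzero trace, unit trace `t`. Its small eigenvalue is `βⁿ/t` modulo
`p²`, so both eigenvalues lie in `R`, and their ratio is `pⁿ` times a unit of `R`.

Zariski density (`SqrtGenerator.isZariskiDense`): along an affine `K`-line a polynomial over `ℚ_p`
becomes a polynomial in `x` and `σ x`. If it vanishes at all powers of `β`, independence of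
characters makes it zero. A polynomial vanishing on the group therefore vanishes on triple products
of the two tori, and these fill a neighbourhood of a matrix. -/

/-- A generator `ω` of a quadratic extension with `ω² ∈ ℚ_p` and `|ω| = 1`, together with the
nontrivial automorphism `σ`. -/
structure SqrtGenerator (p : ℕ) [Fact p.Prime] (K : Type*) [NormedField K]
    [NormedAlgebra ℚ_[p] K] where
  ω : K
  d : ℚ_[p]
  σ : K ≃ₐ[ℚ_[p]] K
  sq_eq : ω ^ 2 = algebraMap ℚ_[p] K d
  norm_ω : ‖ω‖ = 1
  σ_ω : σ ω = -ω
  norm_σ : ∀ x, ‖σ x‖ = ‖x‖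
  decomp : ∀ x, ∃ u v : ℚ_[p], x = algebraMap ℚ_[p] K u + algebraMap ℚ_[p] K v * ω

/-! ### Norms on the quadratic extension, and a square-root generator. -/

section Field

variable {p : ℕ} [Fact p.Prime] {K : Type*} [NormedField K] [NormedAlgebra ℚ_[p] K]

/-- The extension of the `p`-adic norm to `K` is unique, hence equal to the spectral norm, which
depends only on minimal polynomials. -/
theorem norm_algEquiv [FiniteDimensional ℚ_[p] K] (σ : K ≃ₐ[ℚ_[p]] K) (x : K) :
    ‖σ x‖ = ‖x‖ := by
  have h : ∀ y : K, ‖y‖ = spectralNorm ℚ_[p] K y := fun y =>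
    spectralNorm_unique_field_norm_ext (f := NormedField.toAbsoluteValue K)
      (fun z => norm_algebraMap' K z) y
  rw [h, h, ← spectralNorm_eq_of_equiv]

theorem norm_natCast_p : ‖(p : K)‖ = (p : ℝ)⁻¹ := by
  have h : ‖algebraMap ℚ_[p] K (p : ℚ_[p])‖ = ‖(p : ℚ_[p])‖ := norm_algebraMap' K _
  rw [map_natCast] at h
  rw [h, Padic.norm_p]

theorem norm_two (hp : Odd p) : ‖(2 : K)‖ = 1 := by
  have h : ‖algebraMap ℚ_[p] K ((2 : ℕ) : ℚ_[p])‖ = ‖((2 : ℕ) : ℚ_[p])‖ := norm_algebraMap' K _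
  rw [map_natCast] at h
  rw [← Nat.cast_ofNat (R := K), h, Padic.norm_natCast_eq_one_iff]
  exact hp.coprime_two_right

theorem two_ne_zero' (hp : Odd p) : (2 : K) ≠ 0 := by
  rw [← norm_pos_iff, norm_two hp]; exact one_pos

-- If `σ` moves `θ`, then `θ - σ θ` is anti-invariant and its square is rational. Unramifiedness
-- allows a power of `p`, which `σ` fixes, to rescale it to norm one.
open Classical in
theorem exists_sqrtGenerator (hp : Odd p) (hK : IsUnramifiedQuadratic p K) :
    Nonempty (SqrtGenerator p K) := by
  have : Algebra.IsQuadraticExtension ℚ_[p] K := ⟨hK.finrank_eq⟩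
  have : FiniteDimensional ℚ_[p] K := inferInstance
  have hG : Nat.card (K ≃ₐ[ℚ_[p]] K) = 2 := by
    rw [IsGalois.card_aut_eq_finrank, hK.finrank_eq]
  have h2 := two_ne_zero' (K := K) hp
  obtain ⟨σ, hσ⟩ : ∃ σ : K ≃ₐ[ℚ_[p]] K, σ ≠ 1 := by
    have : Nontrivial (K ≃ₐ[ℚ_[p]] K) := Finite.one_lt_card_iff_nontrivial.1 (by omega)
    exact exists_ne 1
  have hall : ∀ τ : K ≃ₐ[ℚ_[p]] K, τ = 1 ∨ τ = σ := by
    intro τ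
    by_contra! h
    have h3 : ({1, σ, τ} : Finset (K ≃ₐ[ℚ_[p]] K)).card = 3 := by
      rw [Finset.card_eq_three]
      exact ⟨1, σ, τ, hσ.symm, h.1.symm, h.2.symm, rfl⟩
    have := Finset.card_le_univ ({1, σ, τ} : Finset (K ≃ₐ[ℚ_[p]] K))
    rw [h3, ← Nat.card_eq_fintype_card, hG] at this
    omega
  have hinv : ∀ x, σ (σ x) = x := by
    intro x
    have h : σ * σ = 1 := by
      rcases hall (σ * σ) with h | h
      · exact h
      · exact absurd (mul_eq_left.1 h) hσ
    exact DFunLike.congr_fun h x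
  have hfix : ∀ x, σ x = x → ∃ u, algebraMap ℚ_[p] K u = x := by
    intro x hx
    have : x ∈ (⊥ : IntermediateField ℚ_[p] K) := by
      rw [IsGalois.mem_bot_iff_fixed]
      intro τ
      rcases hall τ with rfl | rfl
      · rfl
      · exact hx
    exact IntermediateField.mem_bot.1 this
  obtain ⟨θ, hθ⟩ : ∃ θ, σ θ ≠ θ := by
    by_contra! h
    exact hσ (AlgEquiv.ext h)
  have hω0 : θ - σ θ ≠ 0 := sub_ne_zero.2 hθ.symm
  obtain ⟨n, hn⟩ := hK.norm_eq_zpow _ hω0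
  have hp0 : (p : K) ≠ 0 := natCast_p_ne_zero p K
  set ω : K := (p : K) ^ n * (θ - σ θ) with hω
  have hωne : ω ≠ 0 := mul_ne_zero (zpow_ne_zero _ hp0) hω0
  have hσω : σ ω = -ω := by
    rw [hω, map_mul, map_sub, hinv, map_zpow₀, map_natCast]; ring
  obtain ⟨d, hd⟩ := hfix (ω ^ 2) (by rw [map_pow, hσω]; ring)
  refine ⟨⟨ω, d, σ, hd.symm, ?_, hσω, norm_algEquiv σ, fun x => ?_⟩⟩
  · rw [hω, norm_mul, norm_zpow, norm_natCast_p, hn, inv_zpow, inv_mul_cancel₀]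
    exact zpow_ne_zero _ (by exact_mod_cast (Fact.out : p.Prime).ne_zero)
  · obtain ⟨u, hu⟩ := hfix ((x + σ x) / 2) (by rw [map_div₀, map_add, hinv, map_ofNat, add_comm])
    obtain ⟨v, hv⟩ := hfix ((x - σ x) / (2 * ω)) (by
      rw [map_div₀, map_sub, hinv, map_mul, map_ofNat, hσω, mul_neg, div_neg, ← neg_div, neg_sub])
    refine ⟨u, v, ?_⟩
    rw [hu, hv]
    field_simp
    ring

theorem norm_p_lt_one : ‖(p : K)‖ < 1 := by
  rw [norm_natCast_p]
  exact inv_lt_one_of_one_lt₀ (by exact_mod_cast (Fact.out : p.Prime).one_lt)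

theorem norm_p_pos : 0 < ‖(p : K)‖ := norm_pos_iff.2 (natCast_p_ne_zero p K)

theorem norm_p_le_norm_prime {q : ℕ} (hq : q.Prime) : ‖(p : K)‖ ≤ ‖(q : K)‖ := by
  by_cases h : q = p
  · rw [h]
  · have h1 : ‖algebraMap ℚ_[p] K (q : ℚ_[p])‖ = ‖(q : ℚ_[p])‖ := norm_algebraMap' K _
    rw [map_natCast] at h1
    rw [h1, (Padic.norm_natCast_eq_one_iff).2]
    · exact (norm_p_lt_one (p := p) (K := K)).le
    · exact (Nat.coprime_primes Fact.out hq).2 (Ne.symm h)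

theorem norm_add_le_of_le {x y : K} {r : ℝ} (p : ℕ) [Fact p.Prime] [NormedAlgebra ℚ_[p] K]
    (hx : ‖x‖ ≤ r) (hy : ‖y‖ ≤ r) : ‖x + y‖ ≤ r := by
  have := isUltrametricDist p K
  exact (IsUltrametricDist.norm_add_le_max x y).trans (max_le hx hy)

theorem norm_add_lt_of_lt {x y : K} {r : ℝ} (p : ℕ) [Fact p.Prime] [NormedAlgebra ℚ_[p] K]
    (hx : ‖x‖ < r) (hy : ‖y‖ < r) : ‖x + y‖ < r := by
  have := isUltrametricDist p K
  exact (IsUltrametricDist.norm_add_le_max x y).trans_lt (max_lt hx hy)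

theorem norm_sub_le_of_le {x y : K} {r : ℝ} (p : ℕ) [Fact p.Prime] [NormedAlgebra ℚ_[p] K]
    (hx : ‖x‖ ≤ r) (hy : ‖y‖ ≤ r) : ‖x - y‖ ≤ r := by
  rw [sub_eq_add_neg]; exact norm_add_le_of_le p hx (by rwa [norm_neg])

theorem norm_sub_lt_of_lt {x y : K} {r : ℝ} (p : ℕ) [Fact p.Prime] [NormedAlgebra ℚ_[p] K]
    (hx : ‖x‖ < r) (hy : ‖y‖ < r) : ‖x - y‖ < r := by
  rw [sub_eq_add_neg]; exact norm_add_lt_of_lt p hx (by rwa [norm_neg])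

theorem norm_eq_of_sub_lt {x y : K} (p : ℕ) [Fact p.Prime] [NormedAlgebra ℚ_[p] K]
    (h : ‖x - y‖ < ‖y‖) : ‖x‖ = ‖y‖ := by
  have := isUltrametricDist p K
  have h1 := IsUltrametricDist.norm_add_eq_max_of_norm_ne_norm h.ne
  rw [sub_add_cancel] at h1
  rw [h1, max_eq_right h.le]

theorem pow_sub_one_le {u : K} {r : ℝ} (p : ℕ) [Fact p.Prime] [NormedAlgebra ℚ_[p] K]
    (hr : r ≤ 1) (hr0 : 0 ≤ r) (hu : ‖u - 1‖ ≤ r) (i : ℕ) : ‖u ^ i - 1‖ ≤ r := by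
  have hu1 : ‖u‖ ≤ 1 := by
    have := norm_add_le_of_le p (hu.trans hr) (norm_one (α := K)).le
    rwa [sub_add_cancel] at this
  induction i with
  | zero => simpa using hr0
  | succ i ih =>
    rw [show u ^ (i + 1) - 1 = (u ^ i - 1) * u + (u - 1) by ring]
    refine norm_add_le_of_le p ?_ hu
    rw [norm_mul]
    exact (mul_le_of_le_one_right (norm_nonneg _) hu1).trans ih

/-- The group `1 + p²𝒪` has no torsion. -/
theorem eq_one_of_pow_eq_one (m : ℕ) (hm : m ≠ 0) :
    ∀ u : K, ‖u - 1‖ ≤ ‖(p : K)‖ ^ 2 → u ^ m = 1 → u = 1 := by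
  have hp1 : ‖(p : K)‖ < 1 := norm_p_lt_one
  have hp0 : 0 < ‖(p : K)‖ := norm_p_pos
  have hp2 : ‖(p : K)‖ ^ 2 < ‖(p : K)‖ := by nlinarith
  induction m using induction_on_primes with
  | zero => exact absurd rfl hm
  | one => intro u _ h; simpa using h
  | prime_mul q m hq ih =>
    intro u hu h
    refine ih (right_ne_zero_of_mul hm) u hu ?_
    set v := u ^ m
    have hv : ‖v - 1‖ ≤ ‖(p : K)‖ ^ 2 := pow_sub_one_le p (by nlinarith) (by positivity) hu m
    have hvq : v ^ q = 1 := by rw [← pow_mul, mul_comm]; exact h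
    -- If `v ≠ 1`, the sum of the `v ^ i`, `i < q`, is zero; each term is `1` modulo `p²`, so `|q| ≤
    -- |p|²`, whereas `|q| ≥ |p|` for every prime `q`.
    by_contra hne
    have hs : (∑ i ∈ Finset.range q, v ^ i) = 0 := by
      have h0 := geom_sum_mul v q
      rw [hvq, sub_self] at h0
      exact (mul_eq_zero.1 h0).resolve_right (sub_ne_zero.2 hne)
    have hs' : ‖∑ i ∈ Finset.range q, (v ^ i - 1)‖ ≤ ‖(p : K)‖ ^ 2 := by
      have := isUltrametricDist p K
      exact IsUltrametricDist.norm_sum_le_of_forall_le_of_nonneg (by positivity)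
        fun i _ => pow_sub_one_le p (by nlinarith) (by positivity) hv i
    rw [Finset.sum_sub_distrib, hs, Finset.sum_const, Finset.card_range, nsmul_eq_mul, mul_one,
      zero_sub, norm_neg] at hs'
    have := norm_p_le_norm_prime (p := p) (K := K) hq
    linarith

end Field

namespace SqrtGenerator

variable {p : ℕ} [Fact p.Prime] {K : Type*} [NormedField K] [NormedAlgebra ℚ_[p] K]
  (Q : SqrtGenerator p K)

theorem ω_ne_zero : Q.ω ≠ 0 := norm_pos_iff.1 (by rw [Q.norm_ω]; exact one_pos)

/-- Otherwise `x + ω` and its conjugate `x - ω` both have norm below one, and so does their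
difference `2ω`, which is a unit. -/
theorem one_le_norm_add (hp : Odd p) (x : ℚ_[p]) : 1 ≤ ‖algebraMap ℚ_[p] K x + Q.ω‖ := by
  by_contra! h
  have h1 : ‖algebraMap ℚ_[p] K x - Q.ω‖ < 1 := by
    have := Q.norm_σ (algebraMap ℚ_[p] K x + Q.ω)
    rw [map_add, AlgEquiv.commutes, Q.σ_ω, ← sub_eq_add_neg] at this
    rwa [this]
  have h2 := norm_sub_lt_of_lt p h h1
  rw [show algebraMap ℚ_[p] K x + Q.ω - (algebraMap ℚ_[p] K x - Q.ω) = 2 * Q.ω by ring, norm_mul,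
    norm_two hp, Q.norm_ω, mul_one] at h2
  exact lt_irrefl _ h2

theorem norm_le_norm_add (hp : Odd p) (x y : ℚ_[p]) :
    ‖y‖ ≤ ‖algebraMap ℚ_[p] K x + algebraMap ℚ_[p] K y * Q.ω‖ := by
  by_cases hy : y = 0
  · simp [hy]
  · have hy' : algebraMap ℚ_[p] K y ≠ 0 := by simpa using hy
    rw [show algebraMap ℚ_[p] K x + algebraMap ℚ_[p] K y * Q.ω
      = algebraMap ℚ_[p] K y * (algebraMap ℚ_[p] K (x / y) + Q.ω) by
        rw [map_div₀]; field_simp, norm_mul, norm_algebraMap']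
    exact le_mul_of_one_le_right (norm_nonneg _) (Q.one_le_norm_add hp _)

theorem ω_notMem_range (hp : Odd p) : Q.ω ∉ Set.range (algebraMap ℚ_[p] K) := by
  rintro ⟨x, hx⟩
  have := Q.one_le_norm_add hp (-x)
  rw [map_neg, hx, neg_add_cancel, norm_zero] at this
  exact absurd this (by norm_num)

end SqrtGenerator

/-! ### Distances in a graph and sets entered through a single vertex. -/

section Graph

variable {V : Type*} {G : SimpleGraph V} {S : Set V} {o : V}

theorem exists_walk_length_lt (hS : ∀ x y, G.Adj x y → x ∉ S → y ∈ S → x = o) {u w : V}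
    (q : G.Walk u w) (hu : u ∉ S) (hw : w ∈ S) : ∃ q' : G.Walk u o, q'.length < q.length := by
  induction q with
  | nil => exact absurd hw hu
  | @cons a b c h q ih =>
    by_cases hb : b ∈ S
    · obtain rfl := hS a b h hu hb
      exact ⟨.nil, by simp⟩
    · obtain ⟨q', hq'⟩ := ih hb hw
      exact ⟨.cons h q', by simpa using hq'⟩

/-- If every edge entering `S` starts at `o`, a vertex which is closer to a neighbour `w ∈ S` of `o`
than to `o` lies in `S`. -/
theorem mem_of_dist_lt_dist (hS : ∀ x y, G.Adj x y → x ∉ S → y ∈ S → x = o) {u w : V}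
    (hw : w ∈ S) (how : G.Adj o w) (h : G.dist u w < G.dist u o) : u ∈ S := by
  by_contra hu
  -- Distances between unreachable vertices are `0` by convention, so the strict inequality `h`
  -- forces reachability.
  have hr : G.Reachable u o := by
    by_contra hr
    rw [SimpleGraph.dist_eq_zero_of_not_reachable hr] at h
    omega
  obtain ⟨q, hq⟩ := (hr.trans how.reachable).exists_walk_length_eq_dist
  obtain ⟨q', hq'⟩ := exists_walk_length_lt hS q hu hw
  have := SimpleGraph.dist_le q'
  omega

end Graph

/-! ### Lattices, the tree, and half-trees described by row norms. -/

section Lattices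

variable {p : ℕ} [Fact p.Prime] {K : Type*} [NormedField K] [NormedAlgebra ℚ_[p] K]

/-- The matrix has entries in the ring of integers. -/
def IsIntegral₂ (X : Matrix (Fin 2) (Fin 2) K) : Prop := ∀ i j, ‖X i j‖ ≤ 1

/-- The sup norm of a row. -/
def rowNorm (h : Matrix (Fin 2) (Fin 2) K) (i : Fin 2) : ℝ := max ‖h i 0‖ ‖h i 1‖

theorem norm_le_rowNorm (h : Matrix (Fin 2) (Fin 2) K) (i j : Fin 2) : ‖h i j‖ ≤ rowNorm h i := by
  fin_cases j
  · exact le_max_left _ _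
  · exact le_max_right _ _

theorem exists_norm_eq_rowNorm (h : Matrix (Fin 2) (Fin 2) K) (i : Fin 2) :
    ∃ j, ‖h i j‖ = rowNorm h i := by
  rcases max_choice ‖h i 0‖ ‖h i 1‖ with h1 | h1
  · exact ⟨0, h1.symm⟩
  · exact ⟨1, h1.symm⟩

theorem rowNorm_smul (c : K) (h : Matrix (Fin 2) (Fin 2) K) (i : Fin 2) :
    rowNorm (c • h) i = ‖c‖ * rowNorm h i := by
  simp [rowNorm, mul_max_of_nonneg]

theorem rowNorm_mul_le (p : ℕ) [Fact p.Prime] [NormedAlgebra ℚ_[p] K]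
    {h X : Matrix (Fin 2) (Fin 2) K} (hX : IsIntegral₂ X) (i : Fin 2) :
    rowNorm (h * X) i ≤ rowNorm h i := by
  obtain ⟨j, hj⟩ := exists_norm_eq_rowNorm (h * X) i
  rw [← hj, Matrix.mul_apply, Fin.sum_univ_two]
  refine norm_add_le_of_le p ?_ ?_ <;> rw [norm_mul]
  · exact (mul_le_of_le_one_right (norm_nonneg _) (hX _ _)).trans (norm_le_rowNorm _ _ _)
  · exact (mul_le_of_le_one_right (norm_nonneg _) (hX _ _)).trans (norm_le_rowNorm _ _ _)

theorem IsUnramifiedQuadratic.norm_le_of_lt (hK : IsUnramifiedQuadratic p K) {x y : K}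
    (h : ‖x‖ < ‖y‖) : ‖x‖ ≤ ‖(p : K)‖ * ‖y‖ := by
  by_cases hx : x = 0
  · rw [hx, norm_zero]; positivity
  have hy : y ≠ 0 := norm_pos_iff.1 ((norm_nonneg x).trans_lt h)
  obtain ⟨m, hm⟩ := hK.norm_eq_zpow x hx
  obtain ⟨n, hn⟩ := hK.norm_eq_zpow y hy
  have hp1 : (1 : ℝ) < p := by exact_mod_cast (Fact.out : p.Prime).one_lt
  rw [hm, hn] at h
  have hmn := (zpow_lt_zpow_iff_right₀ hp1).1 h
  rw [hm, hn, norm_natCast_p, ← zpow_neg_one, ← zpow_add₀ (by positivity)]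
  exact zpow_le_zpow_right₀ hp1.le (by omega)

/-- An edge entering the half-tree `|row j| < |row i|` starts at the base vertex. -/
theorem exists_eq_smul_of_leave (hK : IsUnramifiedQuadratic p K)
    {a b X Y : Matrix (Fin 2) (Fin 2) K} (hX : IsIntegral₂ X) (hY : IsIntegral₂ Y)
    (hbX : b = a * X) (haY : (p : K) • a = b * Y) {i j : Fin 2} (hij : i ≠ j)
    (ha : rowNorm a j < rowNorm a i) (hb : rowNorm b i ≤ rowNorm b j) :
    ∃ (c : K) (U : Matrix (Fin 2) (Fin 2) K), c ≠ 0 ∧ b = c • U ∧ IsIntegral₂ U ∧ ‖U.det‖ = 1 := by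
  -- Discreteness of the value group sharpens the strict inequality between the rows of `a` by a
  -- factor `|p|`. Combined with `b = aX` and `pa = bY`, this pins both rows of `b` at the norm `N =
  -- |p| |a i r|`.
  have hp0 : 0 < ‖(p : K)‖ := norm_p_pos
  have hp1 : ‖(p : K)‖ < 1 := norm_p_lt_one
  obtain ⟨r, hr⟩ := exists_norm_eq_rowNorm a i
  obtain ⟨l, hl⟩ := exists_norm_eq_rowNorm b j
  have hdisc : ∀ s, ‖a j s‖ ≤ ‖(p : K)‖ * ‖a i r‖ := fun s =>
    hK.norm_le_of_lt ((norm_le_rowNorm a j s).trans_lt (hr ▸ ha))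
  have haj : rowNorm a j ≤ ‖(p : K)‖ * ‖a i r‖ := by
    obtain ⟨s, hs⟩ := exists_norm_eq_rowNorm a j
    rw [← hs]; exact hdisc s
  have hbj : rowNorm b j ≤ rowNorm a j := by rw [hbX]; exact rowNorm_mul_le p hX j
  have hbi : ‖(p : K)‖ * ‖a i r‖ ≤ rowNorm b i := by
    rw [hr, ← rowNorm_smul, haY]; exact rowNorm_mul_le p hY i
  set N := ‖(p : K)‖ * ‖a i r‖ with hN
  have hair : 0 < ‖a i r‖ := by
    rw [hr]; exact lt_of_le_of_lt ((norm_nonneg _).trans (norm_le_rowNorm a j 0)) ha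
  have hNpos : 0 < N := mul_pos hp0 hair
  have hNlt : N < ‖a i r‖ := by rw [hN]; exact mul_lt_of_lt_one_left hair hp1
  have e1 : rowNorm b i = N := le_antisymm (by linarith) hbi
  have e2 : rowNorm b j = N := le_antisymm (by linarith) (by linarith)
  have hbN : ∀ s t, ‖b s t‖ ≤ N := by
    intro s t
    have : s = i ∨ s = j := by omega
    rcases this with rfl | rfl
    · exact e1 ▸ norm_le_rowNorm b s t
    · exact e2 ▸ norm_le_rowNorm b s t
  -- Up to sign this is the determinant with columns `r` of `pa` and `l` of `b`. Since column `r` of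
  -- `pa` is an integral combination of the columns of `b`, it is an integral multiple of `b.det`;
  -- hence `b / (p * a i r)` has unit determinant.
  have hq : ‖(p : K) * (a i r * b j l - a j r * b i l)‖ = N ^ 2 := by
    have h1 : ‖a i r * b j l‖ = ‖a i r‖ * N := by rw [norm_mul, hl, e2]
    have h2 : ‖a i r * b j l - a j r * b i l‖ = ‖a i r * b j l‖ := by
      refine norm_eq_of_sub_lt p ?_
      rw [sub_sub_cancel_left, norm_neg, h1, norm_mul]
      have := mul_le_mul (hdisc r) (hbN i l) (norm_nonneg _) hNpos.le
      nlinarith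
    rw [norm_mul, h2, h1, ← mul_assoc, ← hN, sq]
  have hdet : N ^ 2 ≤ ‖b.det‖ := by
    have hc : ∀ s, (p : K) * a s r = b s 0 * Y 0 r + b s 1 * Y 1 r := by
      intro s
      have := congrFun (congrFun haY s) r
      rwa [Matrix.mul_apply, Fin.sum_univ_two, Matrix.smul_apply, smul_eq_mul] at this
    rw [mul_sub, ← mul_assoc, ← mul_assoc, hc, hc] at hq
    rw [← hq]
    have key : ∃ y : K, ‖y‖ ≤ 1 ∧ ((b i 0 * Y 0 r + b i 1 * Y 1 r) * b j l
        - (b j 0 * Y 0 r + b j 1 * Y 1 r) * b i l) = y * b.det := by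
      rw [Matrix.det_fin_two]
      have hi : (i = 0 ∧ j = 1) ∨ (i = 1 ∧ j = 0) := by omega
      have hl' : l = 0 ∨ l = 1 := by omega
      rcases hi with ⟨rfl, rfl⟩ | ⟨rfl, rfl⟩ <;> rcases hl' with rfl | rfl
      · exact ⟨-Y 1 r, by rw [norm_neg]; exact hY _ _, by ring⟩
      · exact ⟨Y 0 r, hY _ _, by ring⟩
      · exact ⟨Y 1 r, hY _ _, by ring⟩
      · exact ⟨-Y 0 r, by rw [norm_neg]; exact hY _ _, by ring⟩
    obtain ⟨y, hy, e⟩ := key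
    rw [e, norm_mul]
    exact mul_le_of_le_one_left (norm_nonneg _) hy
  have hdet' : ‖b.det‖ ≤ N ^ 2 := by
    rw [Matrix.det_fin_two, sq]
    refine norm_sub_le_of_le p ?_ ?_ <;> rw [norm_mul] <;>
      exact mul_le_mul (hbN _ _) (hbN _ _) (norm_nonneg _) hNpos.le
  have hcN : ‖(p : K) * a i r‖ = N := norm_mul _ _
  have hc0 : (p : K) * a i r ≠ 0 := norm_pos_iff.1 (hcN ▸ hNpos)
  refine ⟨(p : K) * a i r, ((p : K) * a i r)⁻¹ • b, hc0, (smul_inv_smul₀ hc0 b).symm, ?_, ?_⟩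
  · intro s t
    rw [Matrix.smul_apply, smul_eq_mul, norm_mul, norm_inv, hcN, inv_mul_le_one₀ hNpos]
    exact hbN s t
  · rw [Matrix.det_smul, norm_mul, Fintype.card_fin, norm_pow, norm_inv, hcN,
      le_antisymm hdet' hdet, inv_pow, inv_mul_cancel₀ (by positivity)]

theorem lattice_col_mem (h : GL (Fin 2) K) (j : Fin 2) :
    (fun i => (h : Matrix (Fin 2) (Fin 2) K) i j) ∈ lattice p K h := by
  refine ⟨Pi.single j 1, fun i => ?_, ?_⟩
  · change ‖(Pi.single j 1 : Fin 2 → K) i‖ ≤ 1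
    by_cases hij : i = j
    · subst hij; simp
    · simp [hij]
  · ext i; simp

theorem exists_eq_mul_of_lattice_subset {g h : GL (Fin 2) K}
    (hgh : lattice p K h ⊆ lattice p K g) :
    ∃ X : Matrix (Fin 2) (Fin 2) K, IsIntegral₂ X ∧ (h : Matrix (Fin 2) (Fin 2) K) = g * X := by
  choose x hx hx' using fun j => hgh (lattice_col_mem h j)
  refine ⟨Matrix.of fun i j => x j i, fun i j => (hx j i : ‖x j i‖ ≤ 1), ?_⟩
  ext i j
  have := congrFun (hx' j) i
  simpa [Matrix.mulVec, dotProduct, Matrix.mul_apply] using this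

theorem exists_smul_eq_mul_of_lattice_subset {g h : GL (Fin 2) K}
    (hgh : (p : K) • lattice p K g ⊆ lattice p K h) :
    ∃ Y : Matrix (Fin 2) (Fin 2) K, IsIntegral₂ Y ∧ (p : K) • (g : Matrix (Fin 2) (Fin 2) K) = h * Y := by
  choose x hx hx' using fun j =>
    hgh (Set.smul_mem_smul_set (a := (p : K)) (lattice_col_mem g j))
  refine ⟨Matrix.of fun i j => x j i, fun i j => (hx j i : ‖x j i‖ ≤ 1), ?_⟩
  ext i j
  have := congrFun (hx' j) i
  simpa [Matrix.mulVec, dotProduct, Matrix.mul_apply] using this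

theorem vertexOf_scalar_mul (c : Kˣ) (g : GL (Fin 2) K) :
    vertexOf p K (.scalar (Fin 2) c * g) = vertexOf p K g := by
  rw [vertexOf, vertexOf, map_mul, Matrix.ProjGenLinGroup.mk_scalar, one_mul]

theorem scalar_mul_val (c : Kˣ) (g : GL (Fin 2) K) :
    ((Matrix.GeneralLinearGroup.scalar (Fin 2) c * g : GL (Fin 2) K) : Matrix (Fin 2) (Fin 2) K)
      = (c : K) • (g : Matrix (Fin 2) (Fin 2) K) := by
  ext i j
  simp [Matrix.diagonal_mul]

theorem mul_scalar_comm (c : Kˣ) (g : GL (Fin 2) K) :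
    g * .scalar (Fin 2) c = .scalar (Fin 2) c * g := by
  ext i j
  simp [mul_comm]

theorem exists_mul_eq_of_vertexOf_eq {g h : GL (Fin 2) K} (e : vertexOf p K g = vertexOf p K h) :
    ∃ (c : K) (X Y : Matrix (Fin 2) (Fin 2) K), c ≠ 0 ∧ IsIntegral₂ X ∧ IsIntegral₂ Y ∧
      (h : Matrix (Fin 2) (Fin 2) K) = c • (g * X) ∧
      (h : Matrix (Fin 2) (Fin 2) K) * Y = c • (g : Matrix (Fin 2) (Fin 2) K) := by
  rw [vertexOf, vertexOf, QuotientGroup.eq, ← map_inv, ← map_mul] at e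
  obtain ⟨k, hk⟩ := e
  obtain ⟨u, hu⟩ := Matrix.ProjGenLinGroup.mk_eq_mk_iff.1 hk
  set k' := Matrix.GeneralLinearGroup.map (n := Fin 2) (integers p K).subtype k with hk'
  have hh : h = g * (k' * .scalar (Fin 2) u) := by rw [hu]; group
  refine ⟨u, k', (k'⁻¹ : GL (Fin 2) K), u.ne_zero, fun i j => (k.1 i j).2, fun i j => ?_, ?_, ?_⟩
  · rw [hk', ← map_inv]; exact ((k⁻¹ : GL (Fin 2) (integers p K)).1 i j).2
  · have : h = .scalar (Fin 2) u * (g * k') := by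
      rw [hh, ← mul_assoc, mul_scalar_comm]
    rw [this, scalar_mul_val]; rfl
  · have : h * k'⁻¹ = .scalar (Fin 2) u * g := by
      rw [hh, mul_scalar_comm u k', ← mul_scalar_comm u g]; group
    rw [← Matrix.GeneralLinearGroup.coe_mul, this, scalar_mul_val]

theorem vertexOf_eq_of_eq_smul {g h : GL (Fin 2) K} {c : K} {U : Matrix (Fin 2) (Fin 2) K}
    (hc : c ≠ 0) (hU : IsIntegral₂ U) (hdet : ‖U.det‖ = 1)
    (e : (h : Matrix (Fin 2) (Fin 2) K) = c • (g * U)) : vertexOf p K h = vertexOf p K g := by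
  let U' : Matrix (Fin 2) (Fin 2) (integers p K) := Matrix.of fun i j => ⟨U i j, hU i j⟩
  have hmap : U'.map (integers p K).subtype = U := by ext i j; rfl
  have hdet' : (integers p K).subtype U'.det = U.det := by
    rw [RingHom.map_det, RingHom.mapMatrix_apply, hmap]
  have hunit : IsUnit U'.det := by
    rw [isUnit_iff_exists_inv]
    have h0 : U.det ≠ 0 := norm_pos_iff.1 (by rw [hdet]; exact one_pos)
    refine ⟨⟨U.det⁻¹, ?_⟩, Subtype.ext ?_⟩
    · change ‖U.det⁻¹‖ ≤ 1
      rw [norm_inv, hdet, inv_one]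
    · change (integers p K).subtype U'.det * U.det⁻¹ = 1
      rw [hdet', mul_inv_cancel₀ h0]
  let k : GL (Fin 2) (integers p K) := Matrix.GeneralLinearGroup.mk'' U' hunit
  have hh : h = .scalar (Fin 2) (Units.mk0 c hc) *
      (g * Matrix.GeneralLinearGroup.map (n := Fin 2) (integers p K).subtype k) := by
    apply Units.ext
    rw [scalar_mul_val, e]
    rfl
  rw [hh, vertexOf_scalar_mul, vertexOf, vertexOf, eq_comm, QuotientGroup.eq, map_mul,
    inv_mul_cancel_left]
  exact ⟨k, rfl⟩

/-- The vertices `[h]` for which row `j` of `g⁻¹h` is smaller than row `i`. -/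
def halfSet (p : ℕ) [Fact p.Prime] [NormedAlgebra ℚ_[p] K] (g : GL (Fin 2) K) (i j : Fin 2) :
    Set (Vertex p K) :=
  {u | ∃ h : GL (Fin 2) K, u = vertexOf p K h ∧
    rowNorm (g⁻¹ * h : GL (Fin 2) K).1 j < rowNorm (g⁻¹ * h : GL (Fin 2) K).1 i}

/-- Representatives of a vertex differ by a scalar and an element of `GL₂(𝒪)` on the right, which
multiplies both row norms by the same factor. Thus membership in `halfSet` can be tested on any
representative. -/
theorem rowNorm_lt_of_vertexOf_eq {g h k : GL (Fin 2) K} {i j : Fin 2}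
    (e : vertexOf p K h = vertexOf p K k)
    (hlt : rowNorm (g⁻¹ * h : GL (Fin 2) K).1 j < rowNorm (g⁻¹ * h : GL (Fin 2) K).1 i) :
    rowNorm (g⁻¹ * k : GL (Fin 2) K).1 j < rowNorm (g⁻¹ * k : GL (Fin 2) K).1 i := by
  obtain ⟨c, X, Y, hc, hX, hY, e1, e2⟩ := exists_mul_eq_of_vertexOf_eq e
  have hc' : 0 < ‖c‖ := norm_pos_iff.2 hc
  have f1 : (g⁻¹ * k : GL (Fin 2) K).1 = c • ((g⁻¹ * h : GL (Fin 2) K).1 * X) := by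
    simp only [Units.val_mul, e1, Matrix.mul_smul, Matrix.mul_assoc]
  have f2 : (g⁻¹ * k : GL (Fin 2) K).1 * Y = c • (g⁻¹ * h : GL (Fin 2) K).1 := by
    simp only [Units.val_mul, Matrix.mul_assoc, e2, Matrix.mul_smul]
  calc _ = ‖c‖ * rowNorm ((g⁻¹ * h : GL (Fin 2) K).1 * X) j := by rw [f1, rowNorm_smul]
    _ ≤ ‖c‖ * rowNorm (g⁻¹ * h : GL (Fin 2) K).1 j := by gcongr; exact rowNorm_mul_le p hX j
    _ < ‖c‖ * rowNorm (g⁻¹ * h : GL (Fin 2) K).1 i := by gcongr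
    _ = rowNorm ((g⁻¹ * k : GL (Fin 2) K).1 * Y) i := by rw [f2, rowNorm_smul]
    _ ≤ _ := rowNorm_mul_le p hY i

theorem vertexOf_mem_halfSet {g h : GL (Fin 2) K} {i j : Fin 2} :
    vertexOf p K h ∈ halfSet p g i j ↔
      rowNorm (g⁻¹ * h : GL (Fin 2) K).1 j < rowNorm (g⁻¹ * h : GL (Fin 2) K).1 i :=
  ⟨fun ⟨_, e, hk⟩ => rowNorm_lt_of_vertexOf_eq e.symm hk, fun hh => ⟨h, rfl, hh⟩⟩

/-- The relation `pL ⊆ M ⊆ L` is symmetric up to homothety: it also reads `pM ⊆ pL ⊆ M`. Either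
orientation of an edge therefore yields the same data. -/
theorem exists_of_tree_adj {v w : Vertex p K} (h : (tree p K).Adj v w) :
    ∃ (a b : GL (Fin 2) K) (X Y : Matrix (Fin 2) (Fin 2) K), v = vertexOf p K a ∧
      w = vertexOf p K b ∧ IsIntegral₂ X ∧ IsIntegral₂ Y ∧
      (b : Matrix (Fin 2) (Fin 2) K) = a * X ∧
      (p : K) • (a : Matrix (Fin 2) (Fin 2) K) = b * Y := by
  rw [tree, SimpleGraph.fromRel_adj] at h
  obtain ⟨-, ⟨a, b, rfl, rfl, h1, h2⟩ | ⟨a, b, rfl, rfl, h1, h2⟩⟩ := h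
  · obtain ⟨X, hX, eX⟩ := exists_eq_mul_of_lattice_subset h2.1
    obtain ⟨Y, hY, eY⟩ := exists_smul_eq_mul_of_lattice_subset h1.1
    exact ⟨a, b, X, Y, rfl, rfl, hX, hY, eX, eY⟩
  · obtain ⟨X, hX, eX⟩ := exists_eq_mul_of_lattice_subset h2.1
    obtain ⟨Y, hY, eY⟩ := exists_smul_eq_mul_of_lattice_subset h1.1
    refine ⟨b, .scalar (Fin 2) (unitP p K) * a, Y, X, rfl, (vertexOf_scalar_mul _ _).symm, hY, hX,
      ?_, ?_⟩
    · rw [scalar_mul_val]; exact eY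
    · rw [scalar_mul_val, eX, Matrix.smul_mul]; rfl

/-- This is the single-entrance hypothesis of `mem_of_dist_lt_dist`, obtained by moving the frame
`g` to the standard one. -/
theorem eq_vertexOf_of_adj (hK : IsUnramifiedQuadratic p K) {g : GL (Fin 2) K} {i j : Fin 2}
    (hij : i ≠ j) (x y : Vertex p K) (hxy : (tree p K).Adj x y) (hx : x ∉ halfSet p g i j)
    (hy : y ∈ halfSet p g i j) : x = vertexOf p K g := by
  obtain ⟨a, b, X, Y, rfl, rfl, hX, hY, eX, eY⟩ := exists_of_tree_adj hxy.symm
  rw [vertexOf_mem_halfSet] at hx hy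
  obtain ⟨c, U, hc, e, hU, hdet⟩ := exists_eq_smul_of_leave hK (a := (g⁻¹ * a : GL (Fin 2) K).1)
    (b := (g⁻¹ * b : GL (Fin 2) K).1) hX hY
    (by simp only [Units.val_mul, eX, Matrix.mul_assoc])
    (by simp only [Units.val_mul, Matrix.mul_assoc, ← eY, Matrix.mul_smul]) hij hy (not_lt.1 hx)
  refine vertexOf_eq_of_eq_smul hc hU hdet ?_
  rw [← Matrix.mul_smul, ← e, ← Units.val_mul, mul_inv_cancel_left]

theorem mulVec_mem_lattice (g : GL (Fin 2) K) (y : Fin 2 → K) :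
    (g : Matrix (Fin 2) (Fin 2) K).mulVec y ∈ lattice p K g ↔ ∀ i, ‖y i‖ ≤ 1 := by
  constructor
  · rintro ⟨x, hx, e⟩
    have := congrArg ((g⁻¹ : GL (Fin 2) K) : Matrix (Fin 2) (Fin 2) K).mulVec e
    rw [Matrix.mulVec_mulVec, Matrix.mulVec_mulVec, ← Units.val_mul, inv_mul_cancel,
      Units.val_one, Matrix.one_mulVec, Matrix.one_mulVec] at this
    rw [this]; exact hx
  · intro h; exact ⟨y, h, rfl⟩

theorem mulVec_mem_lattice_mul (g h : GL (Fin 2) K) (y : Fin 2 → K) :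
    (g : Matrix (Fin 2) (Fin 2) K).mulVec y ∈ lattice p K (g * h) ↔
      ∀ i, ‖((h⁻¹ : GL (Fin 2) K) : Matrix (Fin 2) (Fin 2) K).mulVec y i‖ ≤ 1 := by
  rw [← mulVec_mem_lattice (p := p) (g * h), Matrix.mulVec_mulVec, ← Units.val_mul, mul_inv_cancel_right]

theorem diag_inv (x : Kˣ) : (diag x)⁻¹ = diag x⁻¹ := by
  apply Units.ext
  rfl

theorem diag_mulVec (x : Kˣ) (y : Fin 2 → K) :
    (diag x : Matrix (Fin 2) (Fin 2) K).mulVec y = ![x * y 0, y 1] := by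
  ext i; fin_cases i <;> simp [diag, Matrix.mulVec_diagonal]

theorem tree_adj_mul_diag (g : GL (Fin 2) K)
    (hne : vertexOf p K g ≠ vertexOf p K (g * diag (unitP p K))) :
    (tree p K).Adj (vertexOf p K g) (vertexOf p K (g * diag (unitP p K))) := by
  have hp1 : ‖(p : K)‖ < 1 := norm_p_lt_one
  have hp0 : 0 < ‖(p : K)‖ := norm_p_pos
  have hpK := natCast_p_ne_zero p K
  have key : ∀ y : Fin 2 → K,
      (g : Matrix (Fin 2) (Fin 2) K).mulVec y ∈ lattice p K (g * diag (unitP p K)) ↔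
        ‖(p : K)‖⁻¹ * ‖y 0‖ ≤ 1 ∧ ‖y 1‖ ≤ 1 := by
    intro y
    rw [mulVec_mem_lattice_mul, diag_inv, diag_mulVec, Fin.forall_fin_two]
    simp [unitP]
  have hsurj : ∀ v, ∃ y, v = (g : Matrix (Fin 2) (Fin 2) K).mulVec y := fun v =>
    ⟨((g⁻¹ : GL (Fin 2) K) : Matrix (Fin 2) (Fin 2) K).mulVec v, by
      rw [Matrix.mulVec_mulVec, ← Units.val_mul, mul_inv_cancel, Units.val_one,
        Matrix.one_mulVec]⟩
  rw [tree, SimpleGraph.fromRel_adj]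
  refine ⟨hne, Or.inl ⟨g, _, rfl, rfl, ⟨?_, ?_⟩, ?_, ?_⟩⟩
  · rintro _ ⟨_, ⟨x, hx, rfl⟩, rfl⟩
    have h0 : ‖x 0‖ ≤ 1 := hx 0
    have h1 : ‖x 1‖ ≤ 1 := hx 1
    change (p : K) • (g : Matrix (Fin 2) (Fin 2) K).mulVec x ∈ _
    rw [← Matrix.mulVec_smul, key]
    simp only [Pi.smul_apply, smul_eq_mul, norm_mul]
    rw [inv_mul_cancel_left₀ hp0.ne']
    exact ⟨h0, by nlinarith [norm_nonneg (x 1)]⟩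
  -- Strictness of the inclusions: `g (0, 1)` lies in the smaller lattice but not in `p` times the
  -- larger; below, `g (1, 0)` lies only in the larger.
  · intro hsub
    obtain ⟨_, ⟨x, hx, rfl⟩, e⟩ := hsub ((key ![0, 1]).2 (by simp))
    have h1 : ‖x 1‖ ≤ 1 := hx 1
    change (p : K) • (g : Matrix (Fin 2) (Fin 2) K).mulVec x = _ at e
    rw [← Matrix.mulVec_smul] at e
    have := Matrix.mulVec_injective_of_isUnit g.isUnit e
    have := congrArg norm (congrFun this 1)
    simp at this
    nlinarith [norm_nonneg (x 1)]
  · intro v hv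
    obtain ⟨y, rfl⟩ := hsurj v
    rw [key] at hv
    rw [mulVec_mem_lattice, Fin.forall_fin_two]
    refine ⟨?_, hv.2⟩
    have := hv.1
    rw [inv_mul_le_one₀ hp0] at this
    linarith
  · intro hsub
    have := (key ![1, 0]).1 (hsub ((mulVec_mem_lattice g _).2 (by simp [Fin.forall_fin_two])))
    simp only [Matrix.cons_val_zero, norm_one, mul_one] at this
    exact absurd (one_lt_inv₀ hp0 |>.2 hp1) (not_lt.2 this.1)

/-- The labelling of the axis of `g` for which `v 1` is the vertex of `g`. -/
def axisLabel (p : ℕ) [Fact p.Prime] [NormedAlgebra ℚ_[p] K] (g : GL (Fin 2) K) (j : ℤ) :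
    Vertex p K := vertexOf p K (g * diag (unitP p K ^ (1 - j)))

theorem diag_one : (diag 1 : GL (Fin 2) K) = 1 := by
  ext i j; fin_cases i <;> fin_cases j <;> simp [diag]

theorem diag_mul (x y : Kˣ) : diag (x * y) = diag x * diag y := by
  ext i j; fin_cases i <;> fin_cases j <;> simp [diag]

theorem axisLabel_one (g : GL (Fin 2) K) : axisLabel p g 1 = vertexOf p K g := by
  simp [axisLabel, diag_one]

theorem vertexOf_notMem_halfSet (g : GL (Fin 2) K) (i j : Fin 2) :
    vertexOf p K g ∉ halfSet p g i j := by
  rw [vertexOf_mem_halfSet, inv_mul_cancel]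
  fin_cases i <;> fin_cases j <;> simp [rowNorm]

/-- For translation length one the half-tree compares distances to `v 2` and `v 1 = [g]`. The
neighbour `v 2` lies in the half-set, whose only entrance is `[g]`. -/
theorem halfTreePos_subset (hK : IsUnramifiedQuadratic p K) (g : GL (Fin 2) K) :
    halfTreePos p 1 (axisLabel p g) ⊆ halfSet p g 0 1 := by
  intro u hu
  have hw : axisLabel p g 2 ∈ halfSet p g 0 1 := by
    rw [axisLabel, vertexOf_mem_halfSet, inv_mul_cancel_left]
    have : (1 : ℝ) < p := by exact_mod_cast (Fact.out : p.Prime).one_lt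
    simp [diag, rowNorm, unitP, norm_natCast_p]
    exact_mod_cast this
  have hne : vertexOf p K g ≠ axisLabel p g 2 := fun e =>
    vertexOf_notMem_halfSet g 0 1 (e ▸ hw)
  have e : g = g * diag (unitP p K ^ (1 - 2 : ℤ)) * diag (unitP p K) := by
    rw [mul_assoc, ← diag_mul]; norm_num [diag_one]
  have hadj := tree_adj_mul_diag (p := p) (g * diag (unitP p K ^ (1 - 2 : ℤ))) (by
    rw [← e]; exact hne.symm)
  rw [← e] at hadj
  refine mem_of_dist_lt_dist (eq_vertexOf_of_adj hK (by decide)) hw hadj.symm ?_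
  rw [← axisLabel_one]
  exact hu

theorem halfTreeNeg_subset (hK : IsUnramifiedQuadratic p K) (g : GL (Fin 2) K) :
    halfTreeNeg p (axisLabel p g) ⊆ halfSet p g 1 0 := by
  intro u hu
  have e : axisLabel p g 0 = vertexOf p K (g * diag (unitP p K)) := by simp [axisLabel]
  have hw : axisLabel p g 0 ∈ halfSet p g 1 0 := by
    rw [axisLabel, vertexOf_mem_halfSet, inv_mul_cancel_left]
    have := norm_p_lt_one (p := p) (K := K)
    simpa [diag, rowNorm, unitP] using this
  have hne : vertexOf p K g ≠ axisLabel p g 0 := fun e =>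
    vertexOf_notMem_halfSet g 1 0 (e ▸ hw)
  have hadj := tree_adj_mul_diag (p := p) g (by rw [← e]; exact hne)
  rw [← e] at hadj
  refine mem_of_dist_lt_dist (eq_vertexOf_of_adj hK (by decide)) hw hadj ?_
  rw [← axisLabel_one]
  exact hu

end Lattices

/-! ### The closed ring `ℤ_p + p²𝒪`, a rotation outside it, and eigenvalue ratios. -/

section NearRational

variable (p : ℕ) [Fact p.Prime] (K : Type*) [NormedField K] [NormedAlgebra ℚ_[p] K]

/-- The ring `ℤ_p + p²𝒪`. -/
def nearRational : Subring K where
  carrier := {x | ∃ c : ℤ_[p], ‖x - algebraMap ℚ_[p] K c‖ ≤ ‖(p : K)‖ ^ 2}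
  zero_mem' := ⟨0, by simp⟩
  one_mem' := ⟨1, by simp⟩
  add_mem' := by
    rintro x y ⟨c, hc⟩ ⟨e, he⟩
    refine ⟨c + e, ?_⟩
    rw [PadicInt.coe_add, map_add, add_sub_add_comm]
    exact norm_add_le_of_le p hc he
  neg_mem' := by
    rintro x ⟨c, hc⟩
    refine ⟨-c, ?_⟩
    rwa [PadicInt.coe_neg, map_neg, neg_sub_neg, norm_sub_rev]
  mul_mem' := by
    rintro x y ⟨c, hc⟩ ⟨e, he⟩
    have hp1 : ‖(p : K)‖ < 1 := norm_p_lt_one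
    have hce : ∀ a : ℤ_[p], ‖algebraMap ℚ_[p] K a‖ ≤ 1 := fun a => by
      rw [norm_algebraMap']; exact a.2
    have hy : ‖y‖ ≤ 1 := by
      have := norm_add_le_of_le p (he.trans (pow_le_one₀ (norm_nonneg _) hp1.le)) (hce e)
      rwa [sub_add_cancel] at this
    refine ⟨c * e, ?_⟩
    rw [PadicInt.coe_mul, map_mul, show ∀ a b : K, x * y - a * b = (x - a) * y + a * (y - b) from
      fun a b => by ring]
    refine norm_add_le_of_le p ?_ ?_ <;> rw [norm_mul]
    · exact (mul_le_of_le_one_right (norm_nonneg _) hy).trans hc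
    · exact (mul_le_of_le_one_left (norm_nonneg _) (hce c)).trans he

variable {p K}

theorem padicInt_mem_nearRational (c : ℤ_[p]) : algebraMap ℚ_[p] K c ∈ nearRational p K :=
  ⟨c, by simp⟩

theorem mem_nearRational_of_norm_sub_le {x y : K} (hx : x ∈ nearRational p K)
    (h : ‖y - x‖ ≤ ‖(p : K)‖ ^ 2) : y ∈ nearRational p K := by
  obtain ⟨c, hc⟩ := hx
  refine ⟨c, ?_⟩
  rw [← sub_add_sub_cancel y x]
  exact norm_add_le_of_le p h hc

theorem norm_le_one_of_mem_nearRational {x : K} (hx : x ∈ nearRational p K) : ‖x‖ ≤ 1 := by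
  obtain ⟨c, hc⟩ := hx
  have := norm_add_le_of_le p (hc.trans (pow_le_one₀ (norm_nonneg _) norm_p_lt_one.le))
    (show ‖algebraMap ℚ_[p] K c‖ ≤ 1 by rw [norm_algebraMap']; exact c.2)
  rwa [sub_add_cancel] at this

theorem inv_mem_nearRational {x : K} (hx : x ∈ nearRational p K) (h1 : ‖x‖ = 1) :
    x⁻¹ ∈ nearRational p K := by
  obtain ⟨c, hc⟩ := hx
  have hp0 : 0 < ‖(p : K)‖ := norm_p_pos
  have hp1 : ‖(p : K)‖ < 1 := norm_p_lt_one
  set C := algebraMap ℚ_[p] K c with hC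
  have hC1 : ‖C‖ = 1 := by
    rw [← h1]
    refine norm_eq_of_sub_lt p ?_
    rw [norm_sub_rev, h1]
    exact hc.trans_lt (pow_lt_one₀ hp0.le hp1 two_ne_zero)
  have hc1 : ‖c‖ = 1 := by rwa [hC, norm_algebraMap', ← PadicInt.norm_def] at hC1
  have hx0 : x ≠ 0 := norm_pos_iff.1 (by rw [h1]; exact one_pos)
  have hC0 : C ≠ 0 := norm_pos_iff.1 (by rw [hC1]; exact one_pos)
  have hinv : algebraMap ℚ_[p] K (c.inv : ℤ_[p]) = C⁻¹ := by
    refine eq_inv_of_mul_eq_one_left ?_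
    rw [hC, ← map_mul, ← PadicInt.coe_mul, PadicInt.inv_mul hc1,
      PadicInt.coe_one, map_one]
  refine ⟨c.inv, ?_⟩
  rw [hinv, inv_sub_inv hx0 hC0, norm_div, norm_mul, h1, hC1, one_mul, div_one, norm_sub_rev]
  exact hc

/-- The ring contains the ball of radius `|p|²` around each of its points. -/
theorem isClosed_nearRational : IsClosed (nearRational p K : Set K) := by
  refine isClosed_of_closure_subset fun y hy => ?_
  obtain ⟨x, hx, hxy⟩ := Metric.mem_closure_iff.1 hy (‖(p : K)‖ ^ 2) (pow_pos norm_p_pos 2)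
  rw [dist_eq_norm] at hxy
  exact mem_nearRational_of_norm_sub_le hx hxy.le

theorem natCast_p_mem_nearRational : (p : K) ∈ nearRational p K := natCast_mem _ p

theorem norm_eq_one_of_mem_rotations {z : K} (hz : z ∈ rotations p K) : ‖z‖ = 1 := by
  obtain ⟨x, hx, y, ⟨⟨w, hw, rfl⟩, -⟩, rfl⟩ := hz
  have hp1 : ‖(p : K)‖ < 1 := norm_p_lt_one
  have hx1 : ‖x‖ = 1 := by
    have h : x ^ (p ^ 2 - 1) = 1 := hx
    have h2 : p ^ 2 - 1 ≠ 0 := by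
      have := Nat.one_lt_pow two_ne_zero (Fact.out : p.Prime).one_lt
      omega
    exact (pow_eq_one_iff_of_nonneg (norm_nonneg x) h2).1 (by rw [← norm_pow, h, norm_one])
  have hw' : ‖w‖ ≤ 1 := hw
  have hy1 : ‖1 + (p : K) * w‖ = ‖(1 : K)‖ := by
    refine norm_eq_of_sub_lt p ?_
    rw [add_sub_cancel_left, norm_mul, norm_one]
    exact (mul_le_of_le_one_right (norm_nonneg _) hw').trans_lt hp1
  simp only [norm_mul, hx1, hy1, norm_one, mul_one]

theorem norm_one_add_p_mul (r : ℤ_[p]) : ‖algebraMap ℚ_[p] K (1 + p * r)‖ = 1 := by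
  have : ‖algebraMap ℚ_[p] K (1 + p * r)‖ = ‖(1 : K)‖ := by
    refine norm_eq_of_sub_lt p ?_
    rw [map_add, map_one, add_sub_cancel_left, map_mul, map_natCast, norm_mul, norm_one,
      norm_algebraMap']
    exact (mul_le_of_le_one_right (norm_nonneg _) r.2).trans_lt norm_p_lt_one
  rw [this, norm_one]

theorem one_add_p_mul_mem (r : ℤ_[p]) : algebraMap ℚ_[p] K (1 + p * r) ∈ nearRational p K := by
  have := padicInt_mem_nearRational (K := K) (1 + (p : ℤ_[p]) * r)
  simpa using this

end NearRational

namespace SqrtGenerator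

variable {p : ℕ} [Fact p.Prime] {K : Type*} [NormedField K] [NormedAlgebra ℚ_[p] K]
  (Q : SqrtGenerator p K)

theorem norm_one_add_mul_ω {x : K} (hx : ‖x‖ < 1) : ‖1 + x * Q.ω‖ = 1 := by
  have : ‖1 + x * Q.ω‖ = ‖(1 : K)‖ := by
    refine norm_eq_of_sub_lt p ?_
    rwa [add_sub_cancel_left, norm_mul, Q.norm_ω, mul_one, norm_one]
  rw [this, norm_one]

theorem norm_one_sub_mul_ω {x : K} (hx : ‖x‖ < 1) : ‖1 - x * Q.ω‖ = 1 := by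
  rw [sub_eq_add_neg, ← neg_mul]
  exact Q.norm_one_add_mul_ω (by rwa [norm_neg])

theorem exists_rotation_notMem (Q : SqrtGenerator p K) (hp : Odd p) (hK : IsUnramifiedQuadratic p K) :
    ∃ z ∈ rotations p K, z ∉ nearRational p K := by
  have hp1 : ‖(p : K)‖ < 1 := norm_p_lt_one
  have hp0 : 0 < ‖(p : K)‖ := norm_p_pos
  have hm := Q.norm_one_sub_mul_ω hp1
  have hm0 : 1 - (p : K) * Q.ω ≠ 0 := norm_pos_iff.1 (by rw [hm]; exact one_pos)
  have hpl := Q.norm_one_add_mul_ω hp1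
  have hpl0 : 1 + (p : K) * Q.ω ≠ 0 := norm_pos_iff.1 (by rw [hpl]; exact one_pos)
  have hprod : 1 - (p : K) ^ 2 * algebraMap ℚ_[p] K Q.d ≠ 0 := by
    rw [← Q.sq_eq, show 1 - (p : K) ^ 2 * Q.ω ^ 2 = (1 - p * Q.ω) * (1 + p * Q.ω) by ring]
    exact mul_ne_zero hm0 hpl0
  refine ⟨1 * ((1 + p * Q.ω) / (1 - p * Q.ω)), Set.mul_mem_mul (one_pow _) ?_, ?_⟩
  · rw [mem_circle_iff p K hK.finrank_eq Q.ω Q.d Q.sq_eq (Q.ω_notMem_range hp)]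
    refine ⟨⟨2 * Q.ω / (1 - p * Q.ω), ?_, ?_⟩, (1 + p ^ 2 * Q.d) / (1 - p ^ 2 * Q.d),
      2 * p / (1 - p ^ 2 * Q.d), ?_, ?_⟩
    · change ‖_‖ ≤ (1 : ℝ)
      rw [norm_div, hm, norm_mul, norm_two hp, Q.norm_ω]; norm_num
    · field_simp; ring
    · simp only [map_div₀, map_add, map_sub, map_mul, map_one, map_pow, map_natCast, map_ofNat]
      field_simp
      rw [← Q.sq_eq]; ring
    · simp only [map_div₀, map_add, map_sub, map_mul, map_one, map_pow, map_natCast, map_ofNat]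
      field_simp
      rw [← Q.sq_eq]; ring
  · rw [one_mul]
    -- Clearing the denominator, `(1 - c) + p(1 + c)ω` has norm at most `|p|²`. The coefficient of
    -- `ω` gives `|1 + c| ≤ |p|`, then `|1 - c| ≤ |p|`, and the sum of `1 + c` and `1 - c` is the
    -- unit `2`.
    rintro ⟨c, hc⟩
    have h1 : ‖1 + p * Q.ω - algebraMap ℚ_[p] K c * (1 - p * Q.ω)‖ ≤ ‖(p : K)‖ ^ 2 := by
      rwa [div_sub' hm0, norm_div, hm, div_one, mul_comm (1 - _)] at hc
    have h2 : 1 + p * Q.ω - algebraMap ℚ_[p] K c * (1 - p * Q.ω)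
        = algebraMap ℚ_[p] K (1 - c) + algebraMap ℚ_[p] K (p * (1 + c)) * Q.ω := by
      simp only [map_sub, map_mul, map_add, map_one, map_natCast]; ring
    have h3 := Q.norm_le_norm_add hp (1 - (c : ℚ_[p])) (p * (1 + c))
    rw [← h2, norm_mul] at h3
    have hpQ : ‖(p : ℚ_[p])‖ = ‖(p : K)‖ := by rw [Padic.norm_p, norm_natCast_p]
    rw [hpQ] at h3
    have h4 : ‖1 + (c : ℚ_[p])‖ ≤ ‖(p : K)‖ := by nlinarith
    have h5 : ‖1 - (c : ℚ_[p])‖ ≤ ‖(p : K)‖ := by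
      have h6 : ‖algebraMap ℚ_[p] K (1 - c)‖ ≤ ‖(p : K)‖ := by
        rw [eq_sub_of_add_eq h2.symm]
        refine norm_sub_le_of_le p (h1.trans (by nlinarith)) ?_
        rw [norm_mul, Q.norm_ω, mul_one, norm_algebraMap', norm_mul, hpQ]
        nlinarith [norm_nonneg (1 + (c : ℚ_[p]))]
      rwa [norm_algebraMap'] at h6
    have h7 := norm_add_le_of_le p h4 h5
    rw [show 1 + (c : ℚ_[p]) + (1 - c) = 2 by ring, norm_two hp] at h7
    linarith

/-- The unit `p(1 + p²ω)`. -/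
def β : Kˣ := Units.mk0 ((p : K) * (1 + (p : K) ^ 2 * Q.ω)) (by
  have := Q.norm_one_add_mul_ω (x := (p : K) ^ 2) (by
    rw [norm_pow]; exact pow_lt_one₀ (norm_nonneg _) norm_p_lt_one two_ne_zero)
  exact mul_ne_zero (natCast_p_ne_zero p K) (norm_pos_iff.1 (by rw [this]; exact one_pos)))

theorem β_val : (Q.β : K) = (p : K) * (1 + (p : K) ^ 2 * Q.ω) := rfl

theorem norm_one_add_sq : ‖1 + (p : K) ^ 2 * Q.ω‖ = 1 :=
  Q.norm_one_add_mul_ω (x := (p : K) ^ 2) (by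
    rw [norm_pow]; exact pow_lt_one₀ (norm_nonneg _) norm_p_lt_one two_ne_zero)

theorem one_add_sq_mem : 1 + (p : K) ^ 2 * Q.ω ∈ nearRational p K :=
  mem_nearRational_of_norm_sub_le (one_mem _) (by
    rw [add_sub_cancel_left, norm_mul, Q.norm_ω, mul_one, norm_pow])

theorem norm_β : ‖(Q.β : K)‖ = ‖(p : K)‖ := by
  rw [β_val, norm_mul, Q.norm_one_add_sq, mul_one]

theorem β_mem : (Q.β : K) ∈ nearRational p K :=
  mul_mem natCast_p_mem_nearRational Q.one_add_sq_mem

/-- The ratio of the two eigenvalues of a matrix over `ℤ_p + p²𝒪` with unit trace and determinant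
`(p(1 + p²ω))ⁿ`. -/
theorem exists_ratio_eq {t l m : K} {n : ℕ} (hn : n ≠ 0) (ht : t ∈ nearRational p K)
    (ht1 : ‖t‖ = 1) (hsum : l + m = t) (hprod : l * m = (Q.β : K) ^ n) (hlt : ‖m‖ < ‖l‖) :
    ∃ ρ ∈ nearRational p K, ‖ρ‖ = 1 ∧ m / l = (p : K) ^ n * ρ := by
  have hp1 : ‖(p : K)‖ < 1 := norm_p_lt_one
  have hp0 : 0 < ‖(p : K)‖ := norm_p_pos
  have hl : ‖l‖ = 1 := by
    rw [← ht1, eq_comm]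
    refine norm_eq_of_sub_lt p ?_
    rwa [← hsum, add_sub_cancel_left]
  have hl0 : l ≠ 0 := norm_pos_iff.1 (by rw [hl]; exact one_pos)
  have ht0 : t ≠ 0 := norm_pos_iff.1 (by rw [ht1]; exact one_pos)
  have hD : ‖(Q.β : K) ^ n‖ ≤ ‖(p : K)‖ := by
    rw [norm_pow, Q.norm_β]; exact pow_le_of_le_one hp0.le hp1.le hn
  have hm : ‖m‖ ≤ ‖(p : K)‖ := by
    rwa [← hprod, norm_mul, hl, one_mul] at hD
  -- From `m t = l m + m²` one gets `m = βⁿ/t + m²/t`, and the last term has norm at most `|p|²`.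
  have hmem : m ∈ nearRational p K := by
    refine mem_nearRational_of_norm_sub_le (x := (Q.β : K) ^ n * t⁻¹)
      (mul_mem (pow_mem Q.β_mem n) (inv_mem_nearRational ht ht1)) ?_
    have : m - (Q.β : K) ^ n * t⁻¹ = m * m * t⁻¹ := by
      rw [← hprod]; field_simp; rw [← hsum]; ring
    rw [this, norm_mul, norm_inv, ht1, inv_one, mul_one, norm_mul, sq]
    exact mul_le_mul hm hm (norm_nonneg _) hp0.le
  have hlmem : l ∈ nearRational p K := by
    rw [eq_sub_of_add_eq hsum]; exact sub_mem ht hmem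
  -- The witness comes from `m / l = l m / l² = βⁿ / l²`.
  refine ⟨(1 + (p : K) ^ 2 * Q.ω) ^ n * (l⁻¹ * l⁻¹), mul_mem (pow_mem Q.one_add_sq_mem n)
    (mul_mem (inv_mem_nearRational hlmem hl) (inv_mem_nearRational hlmem hl)), ?_, ?_⟩
  · rw [norm_mul, norm_pow, Q.norm_one_add_sq, norm_mul, norm_inv, hl]; norm_num
  · rw [← mul_assoc, ← mul_pow, ← β_val, ← hprod]
    field_simp

end SqrtGenerator

/-! ### Rotational parts computed from trace and determinant. -/

section Rotation

variable {p : ℕ} [Fact p.Prime] {K : Type*} [NormedField K] [NormedAlgebra ℚ_[p] K]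

theorem eq_of_zpow_mul_eq {m n : ℤ} {x y : K} (hx : ‖x‖ = 1) (hy : ‖y‖ = 1)
    (h : (p : K) ^ m * x = (p : K) ^ n * y) : x = y := by
  have h1 := congrArg norm h
  rw [norm_mul, norm_mul, hx, hy, mul_one, mul_one, norm_zpow, norm_zpow] at h1
  have h2 : m = n :=
    zpow_right_injective₀ norm_p_pos (norm_p_lt_one (p := p) (K := K)).ne h1
  subst h2
  exact mul_left_cancel₀ (zpow_ne_zero _ (natCast_p_ne_zero p K)) h

theorem mul_diag_mul_inv_trace_det (h : GL (Fin 2) K) (x : Kˣ) :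
    (h * diag x * h⁻¹ : GL (Fin 2) K).1.trace = x + 1 ∧
      (h * diag x * h⁻¹ : GL (Fin 2) K).1.det = x := by
  simp only [Units.val_mul]
  constructor
  · rw [Matrix.trace_mul_comm, ← mul_assoc, ← Units.val_mul, inv_mul_cancel, Units.val_one, one_mul,
      Matrix.trace_fin_two]
    simp [diag]
  · rw [Matrix.det_mul_comm, ← mul_assoc, ← Units.val_mul, inv_mul_cancel, Units.val_one, one_mul,
      Matrix.det_fin_two]
    simp [diag]

/-- The rotational parts of the class of a matrix over `ℤ_p + p²𝒪` with unit trace and determinant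
`(p(1 + p²ω))ⁿ` lie in `ℤ_p + p²𝒪`. -/
theorem SqrtGenerator.rotationalPart_mem_of_trace (Q : SqrtGenerator p K) {M : GL (Fin 2) K} {n : ℕ}
    (hn : n ≠ 0) (ht : M.1.trace ∈ nearRational p K) (ht1 : ‖M.1.trace‖ = 1)
    (hdet : M.1.det = (Q.β : K) ^ n) {Θ : K}
    (h : IsRotationalPart p (Matrix.ProjGenLinGroup.mk M) Θ) : Θ ∈ nearRational p K := by
  obtain ⟨hΘ, g, m, r, x, hm, hx, e⟩ := h
  have hΘ1 := norm_eq_one_of_mem_rotations hΘ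
  obtain ⟨c, hc⟩ := Matrix.ProjGenLinGroup.mk_eq_mk_iff.1 e.symm
  rw [mul_scalar_comm] at hc
  have hM : M.1 = (c : K) • (g * diag x * g⁻¹ : GL (Fin 2) K).1 := by rw [← hc, scalar_mul_val]
  obtain ⟨e1, e2⟩ := mul_diag_mul_inv_trace_det g x
  rw [hM, Matrix.trace_smul, e1, smul_eq_mul] at ht ht1
  rw [hM, Matrix.det_smul, e2, Fintype.card_fin] at hdet
  have hr1 := norm_one_add_p_mul (K := K) r
  set s := algebraMap ℚ_[p] K (1 + p * r) with hs
  have hsΘ : ‖s * Θ‖ = 1 := by rw [norm_mul, hr1, hΘ1, one_mul]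
  have hsmem : s⁻¹ ∈ nearRational p K := inv_mem_nearRational (one_add_p_mul_mem r) hr1
  have hs0 : s ≠ 0 := norm_pos_iff.1 (by rw [hr1]; exact one_pos)
  have hxn : ‖(x : K)‖ ≠ 1 := by
    rw [hx, mul_assoc, norm_mul, hsΘ, mul_one, norm_zpow]
    intro h1
    exact hm (zpow_right_injective₀ norm_p_pos (norm_p_lt_one (p := p) (K := K)).ne
      (h1.trans (zpow_zero _).symm))
  have hc0 : 0 < ‖(c : K)‖ := norm_pos_iff.2 c.ne_zero
  have hfin : ∀ ρ ∈ nearRational p K, s * Θ = ρ → Θ ∈ nearRational p K := by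
    intro ρ hρ h1
    rw [← inv_mul_cancel_left₀ hs0 Θ, h1]
    exact mul_mem hsmem hρ
  -- The eigenvalues of `M` are `c` and `c * x`. If `c * x` is the larger one, the small-to-large
  -- ratio is `x⁻¹`, and `Θ` is recovered from the inverse of `ρ`.
  rcases lt_or_gt_of_ne hxn with hlt | hgt
  · obtain ⟨ρ, hρ, hρ1, hq⟩ := Q.exists_ratio_eq (l := c) (m := c * x) hn ht ht1 (by ring)
      (by rw [← hdet]; ring) (by rw [norm_mul]; exact mul_lt_of_lt_one_right hc0 hlt)
    rw [mul_div_cancel_left₀ _ c.ne_zero, hx, mul_assoc, ← zpow_natCast] at hq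
    exact hfin ρ hρ (eq_of_zpow_mul_eq hsΘ hρ1 hq)
  · obtain ⟨ρ, hρ, hρ1, hq⟩ := Q.exists_ratio_eq (l := c * x) (m := c) hn ht ht1 (by ring)
      (by rw [← hdet]; ring) (by rw [norm_mul]; exact lt_mul_of_one_lt_right hc0 hgt)
    rw [div_mul_cancel_left₀ c.ne_zero, inv_eq_iff_eq_inv, mul_inv, hx, mul_assoc,
      ← zpow_natCast, ← zpow_neg] at hq
    exact hfin _ (inv_mem_nearRational hρ hρ1)
      (eq_of_zpow_mul_eq hsΘ (by rw [norm_inv, hρ1, inv_one]) hq)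

theorem IsRotationalPart.conj {γ : PGL(2, K)} {Θ : K} (h : IsRotationalPart p γ Θ) (δ : PGL(2, K)) :
    IsRotationalPart p (δ * γ * δ⁻¹) Θ := by
  obtain ⟨hΘ, g, m, r, x, hm, hx, rfl⟩ := h
  obtain ⟨k, rfl⟩ := Matrix.ProjGenLinGroup.mk_surjective δ
  refine ⟨hΘ, k * g, m, r, x, hm, hx, ?_⟩
  rw [← map_inv, ← map_mul, ← map_mul]
  congr 1
  group

theorem not_isRotationalPart_one (Θ : K) : ¬ IsRotationalPart p (1 : PGL(2, K)) Θ := by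
  rintro ⟨hΘ, g, m, r, x, hm, hx, e⟩
  rw [← Matrix.ProjGenLinGroup.mk_one] at e
  obtain ⟨c, hc⟩ := Matrix.ProjGenLinGroup.mk_eq_mk_iff.1 e
  rw [one_mul, eq_mul_inv_iff_mul_eq, ← mul_scalar_comm, mul_right_inj] at hc
  have h0 := congrArg (fun M : GL (Fin 2) K => M.1 0 0) hc
  have h1 := congrArg (fun M : GL (Fin 2) K => M.1 1 1) hc
  simp [diag] at h0 h1
  rw [h1] at h0
  have h2 := congrArg norm hx
  rw [← h0, mul_assoc, norm_mul, norm_mul, norm_one_add_p_mul, norm_eq_one_of_mem_rotations hΘ,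
    norm_zpow, mul_one, mul_one, Units.val_one, norm_one] at h2
  exact hm (zpow_right_injective₀ norm_p_pos (norm_p_lt_one (p := p) (K := K)).ne
      (h2.symm.trans (zpow_zero _).symm))

end Rotation

/-! ### Reduced words in the generators, modulo `p`. -/

section Words

variable {p : ℕ} [Fact p.Prime] {K : Type*} [NormedField K] [NormedAlgebra ℚ_[p] K]

theorem norm_mul_sub_mul_lt (p : ℕ) [Fact p.Prime] [NormedAlgebra ℚ_[p] K] {x x' y y' : K}
    (hx : ‖x - x'‖ < 1) (hy : ‖y - y'‖ < 1) (hx1 : ‖x‖ ≤ 1) (hy1 : ‖y'‖ ≤ 1) :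
    ‖x * y - x' * y'‖ < 1 := by
  rw [show x * y - x' * y' = x * (y - y') + (x - x') * y' by ring]
  refine norm_add_lt_of_lt p ?_ ?_ <;> rw [norm_mul]
  · exact (mul_le_of_le_one_left (norm_nonneg _) hx1).trans_lt hy
  · exact (mul_le_of_le_one_right (norm_nonneg _) hy1).trans_lt hx

/-- The matrix `!![1, -1; 1, 1]`. -/
def crossMatrix (hp : Odd p) (K : Type*) [NormedField K] [NormedAlgebra ℚ_[p] K] : GL (Fin 2) K :=
  Matrix.GeneralLinearGroup.mkOfDetNeZero !![1, -1; 1, 1] (by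
    rw [Matrix.det_fin_two_of]
    have := two_ne_zero' (K := K) hp
    norm_num
    exact this)

theorem crossMatrix_inv_val (hp : Odd p) :
    ((crossMatrix hp K)⁻¹ : GL (Fin 2) K).1 = (2 : K)⁻¹ • !![1, 1; -1, 1] := by
  have h2 := two_ne_zero' (K := K) hp
  have h : (crossMatrix hp K).1 * ((2 : K)⁻¹ • !![1, 1; -1, 1]) = 1 := by
    ext i j
    fin_cases i <;> fin_cases j <;> simp [crossMatrix, Matrix.GeneralLinearGroup.mkOfDetNeZero,
      Matrix.mul_apply, Fin.sum_univ_two] <;> field_simp <;> norm_num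
  calc ((crossMatrix hp K)⁻¹ : GL (Fin 2) K).1
      = ((crossMatrix hp K)⁻¹ : GL (Fin 2) K).1 *
        ((crossMatrix hp K).1 * ((2 : K)⁻¹ • !![1, 1; -1, 1])) := by rw [h, mul_one]
    _ = _ := by rw [← mul_assoc, ← Units.val_mul, inv_mul_cancel, Units.val_one, one_mul]

theorem crossMatrix_val_inv (hp : Odd p) :
    (crossMatrix hp K).1⁻¹ = (2 : K)⁻¹ • !![1, 1; -1, 1] := by
  rw [← Matrix.coe_units_inv]
  exact crossMatrix_inv_val hp

/-- The frames of the two axes. -/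
def frame (hp : Odd p) (K : Type*) [NormedField K] [NormedAlgebra ℚ_[p] K] :
    Fin 2 → GL (Fin 2) K := ![1, crossMatrix hp K]

/-- The two generators, hyperbolic of translation length one. -/
def generator (hp : Odd p) (b : Kˣ) (i : Fin 2) : PGL(2, K) :=
  Matrix.ProjGenLinGroup.mk (frame hp K i * diag b⁻¹ * (frame hp K i)⁻¹)

/-- Representatives with coefficients in the ring of integers of the generators and of their
inverses. -/
def letter (hp : Odd p) (b : Kˣ) (s : Fin 2 × Bool) : GL (Fin 2) K :=
  frame hp K s.1 * (cond s.2 (.scalar (Fin 2) b * diag b⁻¹) (diag b)) * (frame hp K s.1)⁻¹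

theorem mk_letter (hp : Odd p) (b : Kˣ) (s : Fin 2 × Bool) :
    Matrix.ProjGenLinGroup.mk (letter hp b s) =
      cond s.2 (generator hp b s.1) (generator hp b s.1)⁻¹ := by
  obtain ⟨i, _ | _⟩ := s
  · simp only [letter, generator, cond_false, ← map_inv]
    congr 1
    rw [mul_inv_rev, mul_inv_rev, inv_inv, diag_inv, inv_inv, mul_assoc]
  · simp only [letter, generator, cond_true]
    rw [← mul_assoc, mul_scalar_comm, mul_assoc, mul_assoc, map_mul,
      Matrix.ProjGenLinGroup.mk_scalar, one_mul, mul_assoc]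

/-- The direction of a letter: its image modulo `p` is `dir s`. -/
def dir (K : Type*) [Field K] (s : Fin 2 × Bool) : Fin 2 → K :=
  if s.1 = 0 then cond s.2 ![1, 0] ![0, 1] else cond s.2 ![1, 1] ![-1, 1]

/-- The linear form of a letter: modulo `p` the letter is `dir s ⊗ form s`. -/
def form (K : Type*) [Field K] (s : Fin 2 × Bool) : Fin 2 → K :=
  if s.1 = 0 then cond s.2 ![1, 0] ![0, 1] else cond s.2 ![2⁻¹, 2⁻¹] ![-2⁻¹, 2⁻¹]

/-- Spectral decomposition: a letter has eigenvalue `1` on its own direction and `b` on that of the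
inverse letter, and each `dir ⊗ form` is the corresponding rank-one projection. -/
theorem letter_val (hp : Odd p) (b : Kˣ) (s : Fin 2 × Bool) (i j : Fin 2) :
    (letter hp b s).1 i j = dir K s i * form K s j + b * (dir K (s.1, !s.2) i * form K (s.1, !s.2) j)
    := by
  obtain ⟨k, e⟩ := s
  have hk : k = 0 ∨ k = 1 := by omega
  rcases hk with rfl | rfl
  · cases e <;> fin_cases i <;> fin_cases j <;> simp [letter, frame, dir, form, diag]
  · cases e <;> fin_cases i <;> fin_cases j <;>
      simp [letter, frame, dir, form, diag, crossMatrix_val_inv, Matrix.mul_apply,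
        Fin.sum_univ_two] <;>
      simp [crossMatrix, Matrix.GeneralLinearGroup.mkOfDetNeZero] <;> ring

theorem norm_dir_le (s : Fin 2 × Bool) (i : Fin 2) : ‖dir K s i‖ ≤ 1 := by
  obtain ⟨k, e⟩ := s
  have hk : k = 0 ∨ k = 1 := by omega
  rcases hk with rfl | rfl <;> cases e <;> fin_cases i <;> simp [dir]

theorem norm_form_le (hp : Odd p) (s : Fin 2 × Bool) (i : Fin 2) : ‖form K s i‖ ≤ 1 := by
  have h2 := norm_two (K := K) hp
  obtain ⟨k, e⟩ := s
  have hk : k = 0 ∨ k = 1 := by omega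
  rcases hk with rfl | rfl <;> cases e <;> fin_cases i <;> simp [form, h2]

/-- The form of `s` kills exactly the direction of the inverse letter. As `p` is odd, the four
directions `∞, 0, 1, -1` stay distinct modulo `p`, so every other pairing is a unit. The hypothesis
is the condition for adjacent letters of a reduced word. -/
theorem norm_pairing (hp : Odd p) (s t : Fin 2 × Bool) (h : s.1 = t.1 → s.2 = t.2) :
    ‖form K s 0 * dir K t 0 + form K s 1 * dir K t 1‖ = 1 := by
  have h2 := norm_two (K := K) hp
  have h2' := two_ne_zero' (K := K) hp
  have h3 : (2 : K)⁻¹ + 2⁻¹ = 1 := by field_simp; norm_num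
  obtain ⟨k, e⟩ := s
  obtain ⟨l, f⟩ := t
  have hk : k = 0 ∨ k = 1 := by omega
  have hl : l = 0 ∨ l = 1 := by omega
  rcases hk with rfl | rfl <;> rcases hl with rfl | rfl <;> cases e <;> cases f <;>
    simp_all [form, dir]

theorem det_letter (hp : Odd p) (b : Kˣ) (s : Fin 2 × Bool) : (letter hp b s).1.det = b := by
  rw [letter, Units.val_mul, Matrix.det_mul_comm, ← Units.val_mul, inv_mul_cancel_left,
    Matrix.det_fin_two]
  cases s.2 <;> simp [diag]

theorem letter_mem (hp : Odd p) {b : Kˣ} (hb : (b : K) ∈ nearRational p K) (s : Fin 2 × Bool)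
    (i j : Fin 2) : (letter hp b s).1 i j ∈ nearRational p K := by
  have h2 : (2 : K)⁻¹ ∈ nearRational p K :=
    inv_mem_nearRational (by exact_mod_cast natCast_mem (nearRational p K) 2) (norm_two hp)
  have hd : ∀ s i, dir K s i ∈ nearRational p K := by
    rintro ⟨k, e⟩ i
    have hk : k = 0 ∨ k = 1 := by omega
    rcases hk with rfl | rfl <;> cases e <;> fin_cases i <;>
      simp [dir, zero_mem, one_mem]
  have hf : ∀ s i, form K s i ∈ nearRational p K := by
    rintro ⟨k, e⟩ i
    have hk : k = 0 ∨ k = 1 := by omega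
    rcases hk with rfl | rfl <;> cases e <;> fin_cases i <;>
      simp [form, zero_mem, one_mem, h2]
  rw [letter_val]
  exact add_mem (mul_mem (hd _ _) (hf _ _)) (mul_mem hb (mul_mem (hd _ _) (hf _ _)))

theorem norm_letter_sub_lt (hp : Odd p) {b : Kˣ} (hb : ‖(b : K)‖ < 1) (s : Fin 2 × Bool)
    (i j : Fin 2) : ‖(letter hp b s).1 i j - dir K s i * form K s j‖ < 1 := by
  rw [letter_val, add_sub_cancel_left, norm_mul, norm_mul]
  have := mul_le_one₀ (norm_dir_le (K := K) (s.1, !s.2) i) (norm_nonneg _)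
    (norm_form_le (K := K) hp (s.1, !s.2) j)
  exact (mul_le_of_le_one_right (norm_nonneg _) this).trans_lt hb

/-- The product of the letters of a word. -/
def wordProd (hp : Odd p) (b : Kˣ) (l : List (Fin 2 × Bool)) : GL (Fin 2) K :=
  (l.map (letter hp b)).prod

theorem wordProd_cons (hp : Odd p) (b : Kˣ) (s : Fin 2 × Bool) (l : List (Fin 2 × Bool)) :
    wordProd hp b (s :: l) = letter hp b s * wordProd hp b l := by
  simp [wordProd]

theorem wordProd_cons_apply (hp : Odd p) (b : Kˣ) (s : Fin 2 × Bool) (l : List (Fin 2 × Bool))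
    (i j : Fin 2) : (wordProd hp b (s :: l)).1 i j =
      (letter hp b s).1 i 0 * (wordProd hp b l).1 0 j +
      (letter hp b s).1 i 1 * (wordProd hp b l).1 1 j := by
  rw [wordProd_cons, Units.val_mul, Matrix.mul_apply, Fin.sum_univ_two]

theorem det_wordProd (hp : Odd p) (b : Kˣ) (l : List (Fin 2 × Bool)) :
    (wordProd hp b l).1.det = (b : K) ^ l.length := by
  induction l with
  | nil => simp [wordProd]
  | cons s l ih =>
    rw [wordProd_cons, Units.val_mul, Matrix.det_mul, ih, det_letter, List.length_cons, pow_succ']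

theorem wordProd_mem (hp : Odd p) {b : Kˣ} (hb : (b : K) ∈ nearRational p K)
    (l : List (Fin 2 × Bool)) : ∀ i j, (wordProd hp b l).1 i j ∈ nearRational p K := by
  induction l with
  | nil =>
    intro i j
    fin_cases i <;> fin_cases j <;> simp [wordProd, zero_mem, one_mem]
  | cons s l ih =>
    intro i j
    rw [wordProd_cons_apply]
    exact add_mem (mul_mem (letter_mem hp hb _ _ _) (ih _ _))
      (mul_mem (letter_mem hp hb _ _ _) (ih _ _))

/-- Modulo `p`, a reduced word is a unit multiple of `dir s ⊗ form t`, where `s` is its first and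
`t` its last letter. -/
theorem exists_norm_wordProd_sub_lt (hp : Odd p) {b : Kˣ} (hb : (b : K) ∈ nearRational p K)
    (hb1 : ‖(b : K)‖ < 1) (l : List (Fin 2 × Bool)) (s t : Fin 2 × Bool)
    (hl : FreeGroup.IsReduced (s :: l)) (ht : t ∈ (s :: l).getLast?) :
    ∃ c : K, ‖c‖ = 1 ∧
      ∀ i j, ‖(wordProd hp b (s :: l)).1 i j - dir K s i * (c * form K t j)‖ < 1 := by
  induction l generalizing s with
  | nil =>
    obtain rfl : s = t := by simpa using ht
    refine ⟨1, norm_one, fun i j => ?_⟩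
    simpa [wordProd] using norm_letter_sub_lt hp hb1 s i j
  | cons a l ih =>
    rw [FreeGroup.isReduced_cons_cons] at hl
    obtain ⟨c, hc, h⟩ := ih a hl.2 (by simpa using ht)
    -- Rank-one matrices multiply by `(v ⊗ φ)(w ⊗ ψ) = φ(w) (v ⊗ ψ)`.
    refine ⟨(form K s 0 * dir K a 0 + form K s 1 * dir K a 1) * c, ?_, fun i j => ?_⟩
    · rw [norm_mul, norm_pairing hp s a hl.1, hc, mul_one]
    · have key : ∀ k, ‖(letter hp b s).1 i k * (wordProd hp b (a :: l)).1 k j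
          - dir K s i * form K s k * (dir K a k * (c * form K t j))‖ < 1 := fun k => by
        refine norm_mul_sub_mul_lt p (norm_letter_sub_lt hp hb1 s i k) (h k j)
          (norm_le_one_of_mem_nearRational (letter_mem hp hb _ _ _)) ?_
        rw [norm_mul, norm_mul, hc, one_mul]
        exact mul_le_one₀ (norm_dir_le _ _) (norm_nonneg _) (norm_form_le hp _ _)
      have h2 := norm_add_lt_of_lt p (key 0) (key 1)
      rw [wordProd_cons_apply]
      convert h2 using 2
      ring

/-- Modulo `p` the trace is a unit times the last letter's form evaluated at the first letter's
direction; cyclic reduction is what makes this pairing a unit. -/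
theorem norm_trace_wordProd (hp : Odd p) {b : Kˣ} (hb : (b : K) ∈ nearRational p K)
    (hb1 : ‖(b : K)‖ < 1) {l : List (Fin 2 × Bool)} (hl : FreeGroup.IsCyclicallyReduced l)
    (hne : l ≠ []) : ‖(wordProd hp b l).1.trace‖ = 1 := by
  obtain ⟨s, l, rfl⟩ := List.exists_cons_of_ne_nil hne
  obtain ⟨t, ht⟩ : ∃ t, t ∈ (s :: l).getLast? := ⟨_, List.getLast?_eq_getLast_of_ne_nil hne⟩
  obtain ⟨c, hc, h⟩ := exists_norm_wordProd_sub_lt hp hb hb1 l s t hl.1 ht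
  have h1 := norm_add_lt_of_lt p (h 0 0) (h 1 1)
  have h2 := norm_pairing (K := K) hp t s (hl.2 t ht s (by simp))
  have h3 : ‖c * (form K t 0 * dir K s 0 + form K t 1 * dir K s 1)‖ = 1 := by
    rw [norm_mul, hc, h2, one_mul]
  rw [← h3, Matrix.trace_fin_two]
  refine norm_eq_of_sub_lt p ?_
  rw [h3]
  convert h1 using 2
  ring

theorem mk_wordProd (hp : Odd p) (b : Kˣ) (l : List (Fin 2 × Bool)) :
    Matrix.ProjGenLinGroup.mk (wordProd hp b l) =
      FreeGroup.lift (generator hp b) (FreeGroup.mk l) := by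
  rw [FreeGroup.lift_mk, wordProd, map_list_prod, List.map_map]
  congr 1
  exact List.map_congr_left fun s _ => mk_letter hp b s

/-- Rotational parts are conjugation invariant, so the word may be replaced by its cyclic reduction;
an empty reduction is the identity, which has no rotational part. -/
theorem SqrtGenerator.rotationalParts_subset (Q : SqrtGenerator p K) (hp : Odd p)
    {γ : PGL(2, K)} (hγ : γ ∈ Subgroup.closure (Set.range (generator hp Q.β))) {Θ : K}
    (h : IsRotationalPart p γ Θ) : Θ ∈ nearRational p K := by
  have hb1 : ‖(Q.β : K)‖ < 1 := by rw [Q.norm_β]; exact norm_p_lt_one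
  rw [← FreeGroup.range_lift_eq_closure] at hγ
  obtain ⟨w, rfl⟩ := hγ
  set l := FreeGroup.reduceCyclically w.toWord with hl
  have hred : FreeGroup.IsCyclicallyReduced l :=
    FreeGroup.reduceCyclically.isCyclicallyReduced FreeGroup.isReduced_toWord
  set u := FreeGroup.mk (FreeGroup.reduceCyclically.conjugator w.toWord) with hu
  have hw : u⁻¹ * w * u⁻¹⁻¹ = FreeGroup.mk l := by
    have e := congrArg FreeGroup.mk
      (FreeGroup.reduceCyclically.conj_conjugator_reduceCyclically w.toWord)
    rw [FreeGroup.mk_toWord, ← FreeGroup.mul_mk, ← FreeGroup.mul_mk, ← FreeGroup.inv_mk] at e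
    rw [← e, ← hu, ← hl]
    group
  have h' := h.conj (FreeGroup.lift (generator hp Q.β) u⁻¹)
  rw [← map_inv, ← map_mul, ← map_mul, hw, ← mk_wordProd] at h'
  by_cases hne : l = []
  · rw [hne] at h'
    exact absurd h' (by simpa [wordProd] using not_isRotationalPart_one Θ)
  · refine Q.rotationalPart_mem_of_trace (n := l.length) (by simpa using hne) ?_
      (norm_trace_wordProd hp Q.β_mem hb1 hred hne) (det_wordProd hp _ _) h'
    rw [Matrix.trace_fin_two]
    exact add_mem (wordProd_mem hp Q.β_mem _ _ _) (wordProd_mem hp Q.β_mem _ _ _)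

end Words

/-! ### Zariski density over `ℚ_p`. -/

section Polynomial

variable {p : ℕ} [Fact p.Prime] {K : Type*} [NormedField K] [NormedAlgebra ℚ_[p] K]

/-- The quotient `β / σ β = (1 + p²ω)/(1 - p²ω)` differs from `1` and lies in the torsion-free group
`1 + p²𝒪`. -/
theorem SqrtGenerator.β_pow_ne (Q : SqrtGenerator p K) (hp : Odd p) {m : ℕ} (hm : m ≠ 0) :
    (Q.β : K) ^ m ≠ Q.σ Q.β ^ m := by
  intro h
  have hp1 : ‖(p : K)‖ < 1 := norm_p_lt_one
  have hp2 : ‖(p : K) ^ 2‖ < 1 := by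
    rw [norm_pow]; exact pow_lt_one₀ (norm_nonneg _) hp1 two_ne_zero
  have hσ : Q.σ Q.β = (p : K) * (1 - (p : K) ^ 2 * Q.ω) := by
    rw [Q.β_val, map_mul, map_add, map_mul, map_pow, map_natCast, map_one, Q.σ_ω]; ring
  have hp0 := natCast_p_ne_zero p K
  have h2 := two_ne_zero' (K := K) hp
  have hden : 1 - (p : K) ^ 2 * Q.ω ≠ 0 :=
    norm_pos_iff.1 (by rw [Q.norm_one_sub_mul_ω hp2]; exact one_pos)
  rw [hσ, Q.β_val, mul_pow, mul_pow] at h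
  have h' := mul_left_cancel₀ (pow_ne_zero m hp0) h
  have e := eq_one_of_pow_eq_one (p := p) m hm
    ((1 + (p : K) ^ 2 * Q.ω) / (1 - (p : K) ^ 2 * Q.ω)) (by
      rw [div_sub_one hden, norm_div, Q.norm_one_sub_mul_ω hp2, div_one,
        show 1 + (p : K) ^ 2 * Q.ω - (1 - (p : K) ^ 2 * Q.ω) = 2 * ((p : K) ^ 2 * Q.ω) by ring,
        norm_mul, norm_two hp, norm_mul, Q.norm_ω, norm_pow]
      simp)
    (by rw [div_pow, h', div_self (pow_ne_zero m hden)])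
  rw [div_eq_one_iff_eq hden] at e
  have : 2 * ((p : K) ^ 2 * Q.ω) = 0 := by linear_combination e
  exact mul_ne_zero h2 (mul_ne_zero (pow_ne_zero 2 hp0) Q.ω_ne_zero) this

/-- Since `|β| = |σ β| = |p|`, norms detect the total degree. Cancelling common factors then leaves
`βᵏ = (σ β)ᵏ`, which forces `k = 0`. -/
theorem SqrtGenerator.monomial_injective (Q : SqrtGenerator p K) (hp : Odd p) :
    Function.Injective fun m : Fin 2 →₀ ℕ => (Q.β : K) ^ m 0 * Q.σ Q.β ^ m 1 := by
  have key : ∀ i j i' j' : ℕ, i' ≤ i →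
      (Q.β : K) ^ i * Q.σ Q.β ^ j = (Q.β : K) ^ i' * Q.σ Q.β ^ j' → i = i' ∧ j = j' := by
    intro i j i' j' hi h
    have hn := congrArg norm h
    simp only [norm_mul, norm_pow, Q.norm_σ, Q.norm_β, ← pow_add] at hn
    have hs : i + j = i' + j' := (pow_right_injective₀ norm_p_pos
      (norm_p_lt_one (p := p) (K := K)).ne) hn
    obtain ⟨k, rfl⟩ := Nat.exists_eq_add_of_le hi
    obtain rfl : j' = k + j := by omega
    by_cases hk : k = 0
    · omega
    · exfalso
      have hσ : Q.σ Q.β ≠ 0 := by simp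
      rw [pow_add, pow_add, mul_assoc] at h
      have h1 := mul_left_cancel₀ (pow_ne_zero i' Q.β.ne_zero) h
      exact Q.β_pow_ne hp hk (mul_right_cancel₀ (pow_ne_zero j hσ) h1)
  intro m m' h
  have : m 0 = m' 0 ∧ m 1 = m' 1 := by
    rcases le_total (m' 0) (m 0) with h0 | h0
    · exact key _ _ _ _ h0 h
    · have := key _ _ _ _ h0 h.symm
      exact ⟨this.1.symm, this.2.symm⟩
  ext i
  fin_cases i
  · exact this.1
  · exact this.2

/-- Each monomial gives a character `n ↦ (βⁱ (σ β)ʲ)ⁿ` of `ℕ`; these are distinct, hence linearly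
independent by Dedekind. -/
theorem SqrtGenerator.eq_zero_of_eval_pow (Q : SqrtGenerator p K) (hp : Odd p)
    (P : MvPolynomial (Fin 2) K)
    (h : ∀ n : ℕ, MvPolynomial.eval ![(Q.β : K) ^ n, Q.σ ((Q.β : K) ^ n)] P = 0) : P = 0 := by
  let χ : (Fin 2 →₀ ℕ) → (Multiplicative ℕ →* K) := fun m =>
    powersHom K ((Q.β : K) ^ m 0 * Q.σ Q.β ^ m 1)
  have hχ : Function.Injective χ := fun m m' e =>
    Q.monomial_injective hp ((powersHom K).injective e)
  have hli := (linearIndependent_monoidHom (Multiplicative ℕ) K).comp χ hχ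
  rw [linearIndependent_iff'] at hli
  have h0 := hli P.support (fun m => P.coeff m) (by
    ext n
    have := h n.toAdd
    rw [MvPolynomial.eval_eq'] at this
    rw [Finset.sum_apply, Pi.zero_apply, ← this]
    refine Finset.sum_congr rfl fun m _ => ?_
    simp only [Pi.smul_apply, Function.comp_apply, smul_eq_mul, χ, powersHom_apply,
      Fin.prod_univ_two, Matrix.cons_val_zero, Matrix.cons_val_one, map_pow]
    ring)
  ext m
  by_cases hm : m ∈ P.support
  · exact h0 m hm
  · simpa using hm

theorem SqrtGenerator.exists_mvPolynomial (Q : SqrtGenerator p K) (hp : Odd p)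
    {f : Matrix (Fin 2) (Fin 2) K → ℚ_[p]} (hf : f ∈ polynomialFunctions p K)
    (N A : Matrix (Fin 2) (Fin 2) K) :
    ∃ P : MvPolynomial (Fin 2) K, ∀ x : K,
      algebraMap ℚ_[p] K (f (N + x • A)) = MvPolynomial.eval ![x, Q.σ x] P := by
  induction hf using Algebra.adjoin_induction with
  | mem f hf =>
    obtain ⟨ℓ, hℓ⟩ := hf
    have h2 := two_ne_zero' (K := K) hp
    have hω := Q.ω_ne_zero
    -- For `x = u + vω` one has `u = (x + σ x)/2` and `v = (x - σ x)/(2ω)`, and `ℓ(xA) = u ℓ(A) + v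
    -- ℓ(ωA)`.
    refine ⟨.C (algebraMap ℚ_[p] K (ℓ N)) +
      .C (algebraMap ℚ_[p] K (ℓ A) / 2) * (.X 0 + .X 1) +
      .C (algebraMap ℚ_[p] K (ℓ (Q.ω • A)) / (2 * Q.ω)) * (.X 0 - .X 1), fun x => ?_⟩
    obtain ⟨u, v, rfl⟩ := Q.decomp x
    have e : ℓ (N + (algebraMap ℚ_[p] K u + algebraMap ℚ_[p] K v * Q.ω) • A)
        = ℓ N + (u * ℓ A + v * ℓ (Q.ω • A)) := by
      rw [map_add, add_smul, map_add, mul_smul, algebraMap_smul, algebraMap_smul, map_smul,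
        map_smul, smul_eq_mul, smul_eq_mul]
    rw [hℓ, e]
    simp [Q.σ_ω]
    field_simp
    ring
  | algebraMap r => exact ⟨.C (algebraMap ℚ_[p] K r), fun x => by simp⟩
  | add f g _ _ hf hg =>
    obtain ⟨P, hP⟩ := hf
    obtain ⟨R, hR⟩ := hg
    exact ⟨P + R, fun x => by rw [Pi.add_apply, map_add, hP, hR, map_add]⟩
  | mul f g _ _ hf hg =>
    obtain ⟨P, hP⟩ := hf
    obtain ⟨R, hR⟩ := hg
    exact ⟨P * R, fun x => by rw [Pi.mul_apply, map_mul, hP, hR, map_mul]⟩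

theorem SqrtGenerator.eq_zero_of_pow (Q : SqrtGenerator p K) (hp : Odd p)
    {f : Matrix (Fin 2) (Fin 2) K → ℚ_[p]} (hf : f ∈ polynomialFunctions p K)
    (N A : Matrix (Fin 2) (Fin 2) K) (h : ∀ n : ℕ, f (N + (Q.β : K) ^ n • A) = 0) (x : K) :
    f (N + x • A) = 0 := by
  obtain ⟨P, hP⟩ := Q.exists_mvPolynomial hp hf N A
  have hP0 : P = 0 := Q.eq_zero_of_eval_pow hp P fun n => by rw [← hP, h, map_zero]
  have := hP x
  rwa [hP0, map_zero, map_eq_zero] at this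

theorem exists_polynomial_line {f : Matrix (Fin 2) (Fin 2) K → ℚ_[p]}
    (hf : f ∈ polynomialFunctions p K) (M N : Matrix (Fin 2) (Fin 2) K) :
    ∃ q : Polynomial ℚ_[p], ∀ t : ℚ_[p], f (M + t • N) = q.eval t := by
  induction hf using Algebra.adjoin_induction with
  | mem f hf =>
    obtain ⟨ℓ, hℓ⟩ := hf
    exact ⟨.C (ℓ M) + .X * .C (ℓ N), fun t => by simp [hℓ]; ring⟩
  | algebraMap r => exact ⟨.C r, fun t => by simp⟩
  | add f g _ _ hf hg =>
    obtain ⟨P, hP⟩ := hf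
    obtain ⟨R, hR⟩ := hg
    exact ⟨P + R, fun x => by rw [Pi.add_apply, hP, hR, Polynomial.eval_add]⟩
  | mul f g _ _ hf hg =>
    obtain ⟨P, hP⟩ := hf
    obtain ⟨R, hR⟩ := hg
    exact ⟨P * R, fun x => by rw [Pi.mul_apply, hP, hR, Polynomial.eval_mul]⟩

-- On a line the function is a one-variable polynomial; having infinitely many zeros near `0`, it
-- also vanishes at `t = 1`.
open Filter Topology in
theorem eq_zero_of_eventually_line {f : Matrix (Fin 2) (Fin 2) K → ℚ_[p]}
    (hf : f ∈ polynomialFunctions p K) (M N : Matrix (Fin 2) (Fin 2) K)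
    (h : ∀ᶠ t : ℚ_[p] in 𝓝 0, f (M + t • N) = 0) : f (M + N) = 0 := by
  obtain ⟨q, hq⟩ := exists_polynomial_line hf M N
  have hq0 : q = 0 := by
    refine Polynomial.eq_zero_of_infinite_isRoot q ?_
    refine (infinite_of_mem_nhds (0 : ℚ_[p]) h).mono fun t ht => ?_
    rw [Set.mem_ofPred_eq, hq] at ht
    exact ht
  have := hq 1
  rwa [one_smul, hq0, Polynomial.eval_zero] at this

open Filter Topology in
/-- Squaring is open away from zero. -/
theorem map_sq_nhds (hfin : FiniteDimensional ℚ_[p] K) {v : K} (hv : 2 * v ≠ 0) :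
    map (fun x : K => x ^ 2) (𝓝 v) = 𝓝 (v ^ 2) := by
  -- The inverse function theorem needs a complete nontrivially normed field; `p` has norm different
  -- from `1`, and finite dimension over `ℚ_p` gives completeness.
  let _ : NontriviallyNormedField K := .ofNormNeOne
    ⟨p, natCast_p_ne_zero p K, (norm_p_lt_one (p := p) (K := K)).ne⟩
  have : CompleteSpace K := FiniteDimensional.complete ℚ_[p] K
  have h := (hasStrictDerivAt_pow 2 v).map_nhds_eq (by simpa using hv)
  exact h

/-- The torus product `diag(x, 1) · g diag(s, 1) g⁻¹ · diag(z, 1)`, up to the scalar `c`. -/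
def torusProd (c x s z : K) : Matrix (Fin 2) (Fin 2) K :=
  !![c * x * z * (s + 1), c * x * (s - 1); c * z * (s - 1), c * (s + 1)]

/-- `torusProd` is affine in each of `x`, `s`, `z` separately, so the three exponents can be freed
one at a time. -/
theorem SqrtGenerator.torusProd_eq_zero (Q : SqrtGenerator p K) (hp : Odd p)
    {f : Matrix (Fin 2) (Fin 2) K → ℚ_[p]} (hf : f ∈ polynomialFunctions p K) {c : K}
    (h : ∀ l m n : ℕ, f (torusProd c ((Q.β : K) ^ l) ((Q.β : K) ^ m) ((Q.β : K) ^ n)) = 0)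
    (x s z : K) : f (torusProd c x s z) = 0 := by
  have ez : ∀ x s z : K, torusProd c x s z = !![0, c * x * (s - 1); 0, c * (s + 1)] +
      z • !![c * x * (s + 1), 0; c * (s - 1), 0] := fun x s z => by
    ext i j; fin_cases i <;> fin_cases j <;> simp [torusProd] <;> ring
  have es : ∀ x s z : K, torusProd c x s z = !![c * x * z, -(c * x); -(c * z), c] +
      s • !![c * x * z, c * x; c * z, c] := fun x s z => by
    ext i j; fin_cases i <;> fin_cases j <;> simp [torusProd] <;> ring
  have ex : ∀ x s z : K, torusProd c x s z = !![0, 0; c * z * (s - 1), c * (s + 1)] +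
      x • !![c * z * (s + 1), c * (s - 1); 0, 0] := fun x s z => by
    ext i j; fin_cases i <;> fin_cases j <;> simp [torusProd] <;> ring
  have h1 : ∀ (l m : ℕ) (z : K), f (torusProd c ((Q.β : K) ^ l) ((Q.β : K) ^ m) z) = 0 := by
    intro l m z
    rw [ez]
    exact Q.eq_zero_of_pow hp hf _ _ (fun n => by rw [← ez]; exact h l m n) z
  have h2 : ∀ (l : ℕ) (s z : K), f (torusProd c ((Q.β : K) ^ l) s z) = 0 := by
    intro l s z
    rw [es]
    exact Q.eq_zero_of_pow hp hf _ _ (fun n => by rw [← es]; exact h1 l n z) s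
  rw [ex]
  exact Q.eq_zero_of_pow hp hf _ _ (fun n => by rw [← ex]; exact h2 n s z) x

/-- For a torus product, `A₀₀A₁₁/(A₀₁A₁₀) = ((s + 1)/(s - 1))²`. A square root `v` of this ratio
determines `s = (v + 1)/(v - 1)`, and the entries then give `c`, `x`, `z`. -/
theorem exists_eq_torusProd (hp : Odd p) {A : Matrix (Fin 2) (Fin 2) K} {v : K}
    (h01 : A 0 1 ≠ 0) (h10 : A 1 0 ≠ 0) (h11 : A 1 1 ≠ 0) (hv0 : v ≠ 0) (hv1 : v ≠ 1)
    (hv : v ^ 2 = A 0 0 * A 1 1 / (A 0 1 * A 1 0)) :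
    ∃ c x s z, c ≠ 0 ∧ A = torusProd c x s z := by
  have h2 := two_ne_zero' (K := K) hp
  have hv1' : v - 1 ≠ 0 := sub_ne_zero.2 hv1
  rw [eq_div_iff (mul_ne_zero h01 h10)] at hv
  have hs1 : (v + 1) / (v - 1) + 1 = 2 * v / (v - 1) := by field_simp; ring
  have hs2 : (v + 1) / (v - 1) - 1 = 2 / (v - 1) := by field_simp; ring
  refine ⟨A 1 1 * (v - 1) / (2 * v), A 0 1 * v / A 1 1, (v + 1) / (v - 1), A 1 0 * v / A 1 1,
    ?_, ?_⟩
  · exact div_ne_zero (mul_ne_zero h11 hv1') (mul_ne_zero h2 hv0)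
  · ext i j
    fin_cases i <;> fin_cases j <;>
      simp only [torusProd, hs1, hs2, Fin.zero_eta, Fin.mk_one, Matrix.of_apply,
        Matrix.cons_val_zero, Matrix.cons_val_one] <;> field_simp
    linear_combination -hv

open Filter Topology in
theorem eventually_eq_torusProd (hp : Odd p) (hfin : FiniteDimensional ℚ_[p] K)
    (N : Matrix (Fin 2) (Fin 2) K) :
    ∀ᶠ t : ℚ_[p] in 𝓝 0, ∃ c x s z, c ≠ 0 ∧ !![2, 1; 1, 2] + t • N = torusProd c x s z := by
  have h2 := two_ne_zero' (K := K) hp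
  let A : ℚ_[p] → Matrix (Fin 2) (Fin 2) K := fun t => !![2, 1; 1, 2] + t • N
  have hA0 : A 0 = !![2, 1; 1, 2] := by simp [A]
  have hcont : ∀ i j, Continuous fun t : ℚ_[p] => A t i j := by
    intro i j
    simp only [A, Matrix.add_apply, Matrix.smul_apply]
    fun_prop
  have hne : ∀ i j, ∀ᶠ t : ℚ_[p] in 𝓝 0, A t i j ≠ 0 := by
    intro i j
    refine (hcont i j).continuousAt.eventually_ne ?_
    rw [hA0]
    fin_cases i <;> fin_cases j <;> simp [h2]
  have hratio : Tendsto (fun t : ℚ_[p] => A t 0 0 * A t 1 1 / (A t 0 1 * A t 1 0)) (𝓝 0)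
      (𝓝 (2 ^ 2)) := by
    have hc : ContinuousAt (fun t : ℚ_[p] => A t 0 0 * A t 1 1 / (A t 0 1 * A t 1 0)) 0 :=
      ((hcont 0 0).mul (hcont 1 1)).continuousAt.div
        ((hcont 0 1).mul (hcont 1 0)).continuousAt (by simp [hA0])
    have := hc.tendsto
    simpa [sq, hA0] using this
  -- At the base matrix the ratio is `4 = 2²`, whose root `2` avoids `0` and `1`; openness of
  -- squaring at `2` provides nearby roots.
  have hsq : ∀ᶠ y : K in 𝓝 (2 ^ 2), ∃ v : K, v ≠ 0 ∧ v ≠ 1 ∧ v ^ 2 = y := by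
    rw [← map_sq_nhds hfin (mul_ne_zero h2 h2), eventually_map]
    have h21 : (2 : K) ≠ 1 := fun h => by
      have : (1 : K) = 0 := by linear_combination h
      exact one_ne_zero this
    filter_upwards [eventually_ne_nhds h2, eventually_ne_nhds h21] with v h0 h1
    exact ⟨v, h0, h1, rfl⟩
  filter_upwards [hne 0 1, hne 1 0, hne 1 1, hratio.eventually hsq] with t h01 h10 h11 hv
  obtain ⟨v, hv0, hv1, hv⟩ := hv
  exact exists_eq_torusProd hp h01 h10 h11 hv0 hv1 hv

theorem diag_pow (x : Kˣ) (n : ℕ) : diag (x ^ n) = diag x ^ n := by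
  induction n with
  | zero => rw [pow_zero, pow_zero, diag_one]
  | succ n ih => rw [pow_succ, pow_succ, diag_mul, ih]

theorem letter_zero_pow (hp : Odd p) (b : Kˣ) (n : ℕ) :
    letter hp b (0, false) ^ n = diag (b ^ n) := by
  simp [letter, frame, diag_pow]

theorem letter_one_pow (hp : Odd p) (b : Kˣ) (n : ℕ) :
    letter hp b (1, false) ^ n = letter hp (b ^ n) (1, false) := by
  simp only [letter, cond_false, diag_pow, conj_pow]

theorem torusProd_eq_letters (hp : Odd p) (b c : Kˣ) (l m n : ℕ) :
    (.scalar (Fin 2) c * (letter hp b (0, false) ^ l * letter hp b (1, false) ^ m *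
      letter hp b (0, false) ^ n) : GL (Fin 2) K).1 =
      torusProd (c * 2⁻¹ : K) ((b : K) ^ l) ((b : K) ^ m) ((b : K) ^ n) := by
  rw [scalar_mul_val, letter_zero_pow, letter_zero_pow, letter_one_pow]
  ext i j
  rw [Matrix.smul_apply, Units.val_mul, Units.val_mul, Matrix.mul_apply, Fin.sum_univ_two,
    Matrix.mul_apply, Matrix.mul_apply, Fin.sum_univ_two, Fin.sum_univ_two]
  simp only [letter_val]
  fin_cases i <;> fin_cases j <;> simp [diag, torusProd, dir, form] <;> ring

/-- The group generated by the two generators is Zariski dense. -/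
theorem SqrtGenerator.isZariskiDense (Q : SqrtGenerator p K) (hp : Odd p)
    (hfin : FiniteDimensional ℚ_[p] K) :
    IsZariskiDense p (Subgroup.closure (Set.range (generator hp Q.β))) := by
  intro Z ⟨S, hS, hZ⟩ hΓ
  have h2 := two_ne_zero' (K := K) hp
  rw [Set.eq_univ_iff_forall]
  intro γ
  obtain ⟨g, rfl⟩ := Matrix.ProjGenLinGroup.mk_surjective γ
  rw [hZ]
  intro f hf
  have hletter : ∀ i, Matrix.ProjGenLinGroup.mk (letter hp Q.β (i, false)) ∈
      Subgroup.closure (Set.range (generator hp Q.β)) := fun i => by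
    rw [mk_letter, cond_false]
    exact inv_mem (Subgroup.subset_closure ⟨i, rfl⟩)
  -- The polynomial `f` need not be homogeneous, but the preimage of `Z` in `GL₂(K)` is stable under
  -- scalars, so `c` remains free. The factor `2` absorbs the `2⁻¹` from the inverse of
  -- `crossMatrix`.
  have hprod : ∀ c : K, c ≠ 0 → ∀ x s z, f (torusProd c x s z) = 0 := by
    intro c hc
    refine Q.torusProd_eq_zero hp (hS hf) fun l m n => ?_
    have := torusProd_eq_letters hp Q.β (Units.mk0 (c * 2) (mul_ne_zero hc h2)) l m n
    rw [Units.val_mk0, mul_inv_cancel_right₀ h2] at this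
    rw [← this]
    refine (hZ _).1 (hΓ ?_) f hf
    rw [map_mul, Matrix.ProjGenLinGroup.mk_scalar, one_mul, map_mul, map_mul, map_pow, map_pow,
      map_pow]
    exact mul_mem (mul_mem (pow_mem (hletter 0) _) (pow_mem (hletter 1) _)) (pow_mem (hletter 0) _)
  have := eq_zero_of_eventually_line (hS hf) !![2, 1; 1, 2] (g.1 - !![2, 1; 1, 2]) (by
    filter_upwards [eventually_eq_torusProd hp hfin (g.1 - !![2, 1; 1, 2])] with t ht
    obtain ⟨c, x, s, z, hc, e⟩ := ht
    rw [e]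
    exact hprod c hc x s z)
  rwa [add_sub_cancel] at this

end Polynomial

/-! ### Disjointness of the four half-trees. -/

section Schottky

variable {p : ℕ} [Fact p.Prime] {K : Type*} [NormedField K] [NormedAlgebra ℚ_[p] K]

/-- The rows of `h` are the difference and the sum of those of `B = (crossMatrix)⁻¹ h`. When one row
of `B` dominates strictly, both rows of `h` have its norm, which excludes the half-sets of the first
axis. -/
theorem rowNorm_eq_of_crossMatrix (hp : Odd p) (h : GL (Fin 2) K) {i j : Fin 2} (hij : i ≠ j)
    (hlt : rowNorm ((crossMatrix hp K)⁻¹ * h : GL (Fin 2) K).1 j <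
      rowNorm ((crossMatrix hp K)⁻¹ * h : GL (Fin 2) K).1 i) (k : Fin 2) :
    rowNorm h.1 k = rowNorm ((crossMatrix hp K)⁻¹ * h : GL (Fin 2) K).1 i := by
  set B := (crossMatrix hp K)⁻¹ * h with hB
  have hh : h = crossMatrix hp K * B := by rw [hB, mul_inv_cancel_left]
  have key : ∀ l, ∃ x y, ‖x‖ = ‖B.1 i l‖ ∧ ‖y‖ = ‖B.1 j l‖ ∧ h.1 k l = x + y := by
    intro l
    have hi : (i = 0 ∧ j = 1) ∨ (i = 1 ∧ j = 0) := by omega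
    have hk : k = 0 ∨ k = 1 := by omega
    have h0 : h.1 0 l = B.1 0 l + -B.1 1 l := by
      rw [hh, Units.val_mul, Matrix.mul_apply, Fin.sum_univ_two]
      simp [crossMatrix, Matrix.GeneralLinearGroup.mkOfDetNeZero]
    have h1 : h.1 1 l = B.1 0 l + B.1 1 l := by
      rw [hh, Units.val_mul, Matrix.mul_apply, Fin.sum_univ_two]
      simp [crossMatrix, Matrix.GeneralLinearGroup.mkOfDetNeZero]
    rcases hi with ⟨rfl, rfl⟩ | ⟨rfl, rfl⟩ <;> rcases hk with rfl | rfl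
    · exact ⟨_, _, rfl, norm_neg _, h0⟩
    · exact ⟨_, _, rfl, rfl, h1⟩
    · exact ⟨_, _, norm_neg _, rfl, h0.trans (add_comm _ _)⟩
    · exact ⟨_, _, rfl, rfl, h1.trans (add_comm _ _)⟩
  refine le_antisymm ?_ ?_
  · obtain ⟨l, hl⟩ := exists_norm_eq_rowNorm h.1 k
    obtain ⟨x, y, hx, hy, e⟩ := key l
    rw [← hl, e]
    exact norm_add_le_of_le p (hx.le.trans (norm_le_rowNorm _ _ _))
      ((hy.le.trans (norm_le_rowNorm _ _ _)).trans hlt.le)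
  · obtain ⟨l, hl⟩ := exists_norm_eq_rowNorm B.1 i
    obtain ⟨x, y, hx, hy, e⟩ := key l
    have : ‖x + y‖ = ‖x‖ := norm_eq_of_sub_lt p (by
      rw [add_sub_cancel_left, hx, hy, hl]
      exact (norm_le_rowNorm _ _ _).trans_lt hlt)
    rw [← hl, ← hx, ← this, ← e]
    exact norm_le_rowNorm _ _ _

theorem disjoint_halfSet_swap (g : GL (Fin 2) K) (i j : Fin 2) :
    Disjoint (halfSet p g i j) (halfSet p g j i) := by
  rw [Set.disjoint_left]
  rintro _ ⟨h, rfl, hh⟩ h'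
  rw [vertexOf_mem_halfSet] at h'
  exact lt_asymm hh h'

theorem disjoint_halfSet_frame (hp : Odd p) {i j k l : Fin 2} (hij : i ≠ j) (hkl : k ≠ l) :
    Disjoint (halfSet p (frame hp K 0) i j) (halfSet p (frame hp K 1) k l) := by
  rw [Set.disjoint_left]
  rintro _ ⟨h, rfl, hh⟩ h'
  rw [vertexOf_mem_halfSet] at h'
  have e : rowNorm h.1 0 = rowNorm h.1 1 :=
    (rowNorm_eq_of_crossMatrix hp h hkl h' 0).trans (rowNorm_eq_of_crossMatrix hp h hkl h' 1).symm
  have hf : frame hp K 0 = 1 := rfl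
  rw [hf, inv_one, one_mul] at hh
  have : (i = 0 ∧ j = 1) ∨ (i = 1 ∧ j = 0) := by omega
  rcases this with ⟨rfl, rfl⟩ | ⟨rfl, rfl⟩
  · exact hh.ne e.symm
  · exact hh.ne e

theorem SqrtGenerator.isSchottky (Q : SqrtGenerator p K) (hp : Odd p)
    (hK : IsUnramifiedQuadratic p K) :
    IsSchottky p (Subgroup.closure (Set.range (generator hp Q.β))) := by
  have hp0 := natCast_p_ne_zero p K
  -- Chosen so that `p⁻¹ a = β⁻¹`, with translation length `1`.
  let a : Kˣ := unitP p K * Q.β⁻¹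
  refine ⟨2, generator hp Q.β, ⟨le_rfl, frame hp K, fun _ => 1, fun _ => a,
    fun i => axisLabel p (frame hp K i), fun i => ⟨le_rfl, ?_, ?_⟩, fun i => ⟨1, fun j => rfl⟩, ?_⟩,
    rfl⟩
  · simp only [a, Units.val_mul, Units.val_inv_eq_inv_val, norm_mul, norm_inv, Q.norm_β]
    exact mul_inv_cancel₀ (norm_p_pos (p := p) (K := K)).ne'
  · simp [generator, a]
  · have hpos := fun i => halfTreePos_subset hK (frame hp K i)
    have hneg := fun i => halfTreeNeg_subset hK (frame hp K i)
    have h01 : (0 : Fin 2) ≠ 1 := by decide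
    have hcross : ∀ {i j k l m n : Fin 2}, m ≠ n → i ≠ j → k ≠ l →
        Disjoint (halfSet p (frame hp K m) i j) (halfSet p (frame hp K n) k l) := by
      intro i j k l m n hmn hij hkl
      have : (m = 0 ∧ n = 1) ∨ (m = 1 ∧ n = 0) := by omega
      rcases this with ⟨rfl, rfl⟩ | ⟨rfl, rfl⟩
      · exact disjoint_halfSet_frame hp hij hkl
      · exact (disjoint_halfSet_frame hp hkl hij).symm
    have hsame : ∀ m n, Disjoint (halfSet p (frame hp K m) 0 1) (halfSet p (frame hp K n) 1 0) := by
      intro m n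
      by_cases hmn : m = n
      · subst hmn; exact disjoint_halfSet_swap _ _ _
      · exact hcross hmn h01 h01.symm
    rintro (m | m) (n | n) hmn
    · exact (hcross (fun e => hmn (congrArg Sum.inl e)) h01 h01).mono (hpos m) (hpos n)
    · exact (hsame m n).mono (hpos m) (hneg n)
    · exact (hsame n m).symm.mono (hneg m) (hpos n)
    · exact (hcross (fun e => hmn (congrArg Sum.inr e)) h01.symm h01.symm).mono (hneg m) (hneg n)

end Schottky

end PadicSchottky

end

theorem mainTheorem12 (p : ℕ) [Fact p.Prime] (hp : Odd p) (K : Type*) [NormedField K]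
    [NormedAlgebra ℚ_[p] K] (hK : PadicSchottky.IsUnramifiedQuadratic p K) :
    ∃ Γ : Subgroup PGL(2, K), PadicSchottky.IsSchottky p Γ ∧ PadicSchottky.IsZariskiDense p Γ ∧
      ¬ (PadicSchottky.rotations p K ⊆ closure (PadicSchottky.rotationalParts p Γ)) ∧
      ¬ PadicSchottky.HasDenseRotation p Γ := by
  obtain ⟨Q⟩ := PadicSchottky.exists_sqrtGenerator hp hK
  have hfin : FiniteDimensional ℚ_[p] K :=
    Module.finite_of_finrank_pos (by rw [hK.finrank_eq]; norm_num)
  obtain ⟨z, hz, hz'⟩ := Q.exists_rotation_notMem hp hK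
  refine ⟨_, Q.isSchottky hp hK, Q.isZariskiDense hp hfin, fun h => hz' ?_, ?_⟩
  · refine closure_minimal ?_ PadicSchottky.isClosed_nearRational (h hz)
    rintro Θ ⟨γ, hγ, hΘ⟩
    exact Q.rotationalParts_subset hp hγ hΘ
  · rintro ⟨γ, hγ, Θ, hΘ, h⟩
    refine hz' (closure_minimal ?_ PadicSchottky.isClosed_nearRational (h hz))
    rintro _ ⟨n, rfl⟩
    exact pow_mem (Q.rotationalParts_subset hp hγ hΘ) n
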